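/- There are absolute constants $0<c\le C<\infty$ such that the following holds for every compact abelian topological group $G$ with normalized Haar measure, every set $S$, and every family $\lambda=(\lambda_{\gamma,s})$ of non-negative reals indexed by $\gamma\in\Gamma^{\oplus\mathbb N}$ and $s\in S$, where $\Gamma$ is the dual group of $G$, written additively. Let $\mathcal H=\ell^2(S)$ (complex scalars) with standard unit vectors $e_s$. Equip $G^{\mathbb N}$ with the product measure, and for $k\ge 0$ let $\mathcal F_k$ be the $\sigma$-algebra generated by $x\mapsto(x_1,\dots,x_k)$. For $f\in L^1(G^{\mathbb N},\mathcal H)$ put $\Delta_0f=\mathbb E f$ and $\Delta_kf=\mathbb E(f\mid\mathcal F_k)-\mathbb E(f\mid\mathcal F_{k-1})$ for $k\ge1$. Let $H^1=H^1(G^{\mathbb N},[(\mathcal F_k)_{k=0}^\infty],\mathcal H)$ be the space of those $f\in L^1(G^{\mathbb N},\mathcal H)$ for which $$\|f\|_{H^1}=\mathbb E\Big(\sum_{k=0}^\infty\|\Delta_kf\|_{\mathcal H}^2\Big)^{1/2}<\infty .$$ For $\gamma\in\Gamma^{\oplus\mathbb N}$ let $\widehat f(\gamma)=\int\overline{\gamma(x)}f(x)\,dx\in\mathcal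 H$, where $\gamma(x)=\prod_j\gamma_j(x_j)$, and let $\|\lambda\|_{H^1\to\ell^1}\in[0,\infty]$ be the least $A$ such that $$\sum_{\gamma\in\Gamma^{\oplus\mathbb N}}\sum_{s\in S}\lambda_{\gamma,s}\,\big|\langle\widehat f(\gamma),e_s\rangle\big|\le A\,\|f\|_{H^1}\qquad\text{for all }f\in H^1 .$$ Identify $\Gamma^k$ with the set of $\gamma\in\Gamma^{\oplus\mathbb N}$ with $\gamma_j=0$ for $j>k$, and $\Gamma^{[k+1,\infty)}$ with the set of $\gamma'\in\Gamma^{\oplus\mathbb N}$ with $\gamma'_j=0$ for $j\le k$; for such $\gamma,\gamma'$ write $\gamma\otimes\gamma'$ for the element with coordinates $\gamma_j$ ($j\le k$) and $\gamma'_j$ ($j>k$). Define $$\|\lambda\|_*=\sup_{k\ge0}\Big(\sum_{\gamma'\in\Gamma^{[k+1,\infty)}\setminus\{0\}}\ \sum_{s\in S}\Big(\sum_{\gamma\in\Gamma^k}\lambda_{\gamma\otimes\gamma',s}\Big)^2\Big)^{1/2}+\sup_{k\ge0}\Big(\sum_{s\in S}\Big(\sum_{\gamma\in\Gamma^k,\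 \gamma_k\ne0}\lambda_{\gamma,s}\Big)^2\Big)^{1/2},$$ where for $k=0$ the condition $\gamma_k\neq0$ is void, so that the $k=0$ expression in the second supremum is $\big(\sum_s\lambda_{0,s}^2\big)^{1/2}$. Then $$c\,\|\lambda\|_*\le\|\lambda\|_{H^1\to\ell^1}\le C\,\|\lambda\|_* ,$$ where both sides may be infinite. In particular $\lambda$ is a multiplier from $H^1$ to $\ell^1(\Gamma^{\oplus\mathbb N}\times S)$ if and only if $\|\lambda\|_*<\infty$. -/

import Mathlib

open MeasureTheory ProbabilityTheory
open scoped NNReal ENNReal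

noncomputable section

namespace HardyMultiplier

/-- The direct sum of countably many copies of the dual group `Γ` of `G`, written additively.
It is the dual group of the product `ℕ → G`. The coordinates are numbered `0, 1, 2, …`, so that
the first `k` coordinates are those with index `j < k`. -/
abbrev Freq (G : Type*) [CommGroup G] [TopologicalSpace G] : Type _ :=
  ℕ →₀ Additive (PontryaginDual G)

/-- The Hilbert space `ℓ²(S)` over the complex numbers. -/
abbrev Hil (S : Type*) : Type _ := lp (fun _ : S => ℂ) 2

section Sums

variable {G : Type*} [CommGroup G] [TopologicalSpace G]

/-- The character `x ↦ ∏ j, γ j (x j)` of `ℕ → G` given by `γ`. -/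
def character (γ : Freq G) (x : ℕ → G) : ℂ :=
  ((γ.prod fun j χ => (Additive.toMul χ) (x j) : Circle) : ℂ)

/-- `Γ^k`: the frequencies living on the first `k` coordinates. -/
def headFreq (G : Type*) [CommGroup G] [TopologicalSpace G] (k : ℕ) : Set (Freq G) :=
  {γ | ∀ j, k ≤ j → γ j = 0}

/-- `Γ^[k+1,∞) \ {0}`: the nonzero frequencies that vanish on the first `k` coordinates. -/
def tailFreq (G : Type*) [CommGroup G] [TopologicalSpace G] (k : ℕ) : Set (Freq G) :=
  {γ | (∀ j, j < k → γ j = 0) ∧ γ ≠ 0}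

/-- The frequencies in `Γ^k` whose `k`-th (that is, last) entry is nonzero. For `k = 0` there is
no such entry and no condition: the set is `Γ^0 = {0}`. -/
def lastFreq (G : Type*) [CommGroup G] [TopologicalSpace G] (k : ℕ) : Set (Freq G) :=
  {γ | γ ∈ headFreq G k ∧ (0 < k → γ (k - 1) ≠ 0)}

/-- `sup_k (∑_{γ' ∈ Γ^[k+1,∞) \ {0}} ∑_s (∑_{γ ∈ Γ^k} λ_{γ ⊗ γ', s})²)^{1/2}`. -/
def tailTerm {S : Type*} (lam : Freq G → S → ℝ≥0) : ℝ≥0∞ :=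
  ⨆ k : ℕ, (∑' γ' : tailFreq G k, ∑' s : S,
    (∑' γ : headFreq G k, (lam ((γ : Freq G) + (γ' : Freq G)) s : ℝ≥0∞)) ^ 2) ^ (1 / 2 : ℝ)

/-- `sup_k (∑_s (∑_{γ ∈ Γ^k, γ_k ≠ 0} λ_{γ, s})²)^{1/2}`. -/
def lastTerm {S : Type*} (lam : Freq G → S → ℝ≥0) : ℝ≥0∞ :=
  ⨆ k : ℕ, (∑' s : S, (∑' γ : lastFreq G k, (lam (γ : Freq G) s : ℝ≥0∞)) ^ 2) ^ (1 / 2 : ℝ)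

end Sums

section Hardy

variable {G : Type*} [MeasurableSpace G] {S : Type*}

/-- The product measure on `ℕ → G`. -/
def prodMeasure (μ : Measure G) [IsProbabilityMeasure μ] : Measure (ℕ → G) :=
  Measure.infinitePi fun _ : ℕ => μ

/-- The sigma-algebra `ℱ_k` on `ℕ → G` generated by the first `k` coordinates. -/
abbrev canonicalSigma (G : Type*) [MeasurableSpace G] (k : ℕ) : MeasurableSpace (ℕ → G) :=
  cylinderEvents (Set.Iio k)

/-- The martingale differences `Δ_0 f = E(f | ℱ_0)` and
`Δ_{k+1} f = E(f | ℱ_{k+1}) - E(f | ℱ_k)`. -/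
def martDiff (μ : Measure G) [IsProbabilityMeasure μ] (f : (ℕ → G) → Hil S) :
    ℕ → (ℕ → G) → Hil S
  | 0 => (prodMeasure μ)[f | canonicalSigma G 0]
  | k + 1 => (prodMeasure μ)[f | canonicalSigma G (k + 1)] - (prodMeasure μ)[f | canonicalSigma G k]

/-- The norm of the martingale Hardy space: `E (∑_k ‖Δ_k f‖²)^{1/2}`. -/
def hardyNorm (μ : Measure G) [IsProbabilityMeasure μ] (f : (ℕ → G) → Hil S) : ℝ≥0∞ :=
  ∫⁻ x, (∑' k : ℕ, ‖martDiff μ f k x‖ₑ ^ 2) ^ (1 / 2 : ℝ) ∂(prodMeasure μ)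

/-- `f` belongs to the `ℓ²(S)`-valued martingale Hardy space `H¹`. -/
def MemHardy (μ : Measure G) [IsProbabilityMeasure μ] (f : (ℕ → G) → Hil S) : Prop :=
  Integrable f (prodMeasure μ) ∧ hardyNorm μ f < ∞

variable [CommGroup G] [TopologicalSpace G]

/-- The Fourier coefficient `∫ conj(γ(x)) f(x) dx`, a vector of `ℓ²(S)`. -/
def fourierCoefficient (μ : Measure G) [IsProbabilityMeasure μ] (f : (ℕ → G) → Hil S)
    (γ : Freq G) : Hil S :=
  ∫ x, (starRingEnd ℂ (character γ x)) • f x ∂(prodMeasure μ)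

/-- The norm of `lam` as a Fourier multiplier from `H¹` to `ℓ¹`: the least `C ∈ [0, ∞]` with
`∑_{γ,s} λ_{γ,s} |⟨f̂(γ), e_s⟩| ≤ C ‖f‖` for all `f` in `H¹`. It is finite exactly when `lam` is
a multiplier. -/
def multiplierNorm (μ : Measure G) [IsProbabilityMeasure μ] (lam : Freq G → S → ℝ≥0) : ℝ≥0∞ :=
  sInf {C : ℝ≥0∞ | ∀ f : (ℕ → G) → Hil S, MemHardy μ f →
    ∑' p : Freq G × S, (lam p.1 p.2 : ℝ≥0∞) * ‖fourierCoefficient μ f p.1 p.2‖ₑ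
      ≤ C * hardyNorm μ f}

end Hardy

end HardyMultiplier

end

/-!
Pair `f` with a polynomial `b = ∑ a_{γ,s} γ(x) e_s` whose coefficients satisfy `|a| ≤ λ`, where
the phases of the coefficients turn the pairing into `∑ λ_{γ,s} |⟨f̂(γ), e_s⟩|`. The level of a
frequency `γ`, the number of coordinates it needs, decides the martingale difference it belongs
to: the Fourier coefficient of `f` at a frequency of level `k` is that of `Δ_k f`. Thus the
pairing is `∑_k E⟨b_k, Δ_k f⟩`, with `b_k` the part of `b` of level `k`.

*Upper bound.* The Fefferman–Garsia inequality (`sum_integral_mul_le`) bounds this sum by the `H¹`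
norm of `f` times the martingale `BMO` norm of `b`, that is, the supremum over `j` of the sup norm
of `E(∑_{k ≥ j} ‖b_k‖² | ℱ_j)^{1/2}`. Expanding the squares, only pairs of frequencies that agree
modulo `Γ^j` survive the conditioning, and the sum of the products of their coefficients is at
most `∑_{γ',s} (∑_γ λ_{γ ⊗ γ',s})²` for the levels above `j`, and at most `∑_s (∑_γ λ_{γ,s})²` for
the level `j` itself (`sum_levelPairs_le`). So the `BMO` norm is at most the sum of the two
suprema.

*Lower bound.* Let `K ≥ 0` be an approximate identity in the first `k` coordinates with mean `1`
(`exists_kernel`). For the first supremum, test with `K(x) ∑ c_{γ',s} γ'(x) e_s`, the sum running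
over tail frequencies `γ'`: its norm is at most the `ℓ²` norm of `c`, by the Cauchy–Schwarz
inequality with respect to `K`, and its coefficient at `(γ ⊗ γ', s)` is about `c_{γ',s}`
(`exists_tailFreq_test`). For the second, test with `(K - E(K | ℱ_{k-1})) ∑ c_s e_s`, whose only
nonzero martingale difference is the one of index `k` (`exists_lastFreq_test`). Choosing for `c`
the sums of `λ` over finite sets of heads `γ` gives both suprema (`sum_sq_le_of_test`).

Every orthogonality relation used comes from `integral_character_smul_eq_zero`, which needs
nothing but the translation invariance of the product measure.
-/

namespace HardyMultiplier

/-! ### Characters and the coordinate filtration -/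

section Filtration

variable {G : Type*} [MeasurableSpace G]

lemma canonicalSigma_le (k : ℕ) : canonicalSigma G k ≤ MeasurableSpace.pi := cylinderEvents_le_pi

lemma canonicalSigma_mono {k l : ℕ} (h : k ≤ l) : canonicalSigma G k ≤ canonicalSigma G l :=
  cylinderEvents_mono (Set.Iio_subset_Iio h)

/-- A strongly `ℱ_k`-measurable function depends on the first `k` coordinates only. -/
lemma dependsOn_of_stronglyMeasurable {E : Type*} [TopologicalSpace E]
    [TopologicalSpace.PseudoMetrizableSpace E] [T1Space E] {k : ℕ} {g : (ℕ → G) → E}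
    (hg : StronglyMeasurable[canonicalSigma G k] g) : DependsOn g (Set.Iio k) := by
  refine dependsOn_iff_factorsThrough.2 (StronglyMeasurable.factorsThrough (hg.mono ?_))
  rw [canonicalSigma, cylinderEvents, MeasurableSpace.pi, MeasurableSpace.comap_iSup]
  refine iSup₂_le fun i hi => le_iSup_of_le ⟨i, hi⟩ ?_
  rw [MeasurableSpace.comap_comp]
  rfl

end Filtration

section Characters

variable {G : Type*} [CommGroup G] [TopologicalSpace G]

lemma character_add (γ δ : Freq G) (x : ℕ → G) :
    character (γ + δ) x = character γ x * character δ x := by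
  unfold character
  rw [Finsupp.prod_add_index' (fun _ => by simp) (fun _ _ _ => rfl), Circle.coe_mul]

lemma character_zero (x : ℕ → G) : character (0 : Freq G) x = 1 := by
  simp [character]

lemma norm_character (γ : Freq G) (x : ℕ → G) : ‖character γ x‖ = 1 := Circle.norm_coe _

lemma character_neg (γ : Freq G) (x : ℕ → G) :
    character (-γ) x = starRingEnd ℂ (character γ x) := by
  have h : character γ x * character (-γ) x = 1 := by
    rw [← character_add, add_neg_cancel, character_zero]
  have h' : character γ x * starRingEnd ℂ (character γ x) = 1 := by
    rw [Complex.mul_conj, Complex.normSq_eq_norm_sq, norm_character]; simp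
  exact mul_left_cancel₀ (left_ne_zero_of_mul_eq_one h) (h.trans h'.symm)

lemma character_mul (γ : Freq G) (x y : ℕ → G) :
    character γ (x * y) = character γ x * character γ y := by
  unfold character
  rw [← Circle.coe_mul, ← Finsupp.prod_mul]
  simp [Finsupp.prod]

lemma character_mulSingle (γ : Freq G) (j : ℕ) (t : G) :
    character γ (Pi.mulSingle j t) = ((Additive.toMul (γ j)) t : Circle) := by
  unfold character
  rw [Finsupp.prod, Finset.prod_eq_single j]
  · simp
  · intro i _ hi
    simp [Pi.mulSingle_eq_of_ne hi]
  · intro h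
    simp [Finsupp.notMem_support_iff.1 h]

lemma neg_mem_headFreq {k : ℕ} {γ : Freq G} : -γ ∈ headFreq G k ↔ γ ∈ headFreq G k := by
  simp [headFreq]

lemma sub_mem_headFreq {k : ℕ} {γ δ : Freq G} (hγ : γ ∈ headFreq G k) (hδ : δ ∈ headFreq G k) :
    γ - δ ∈ headFreq G k := fun j hj => by simp [hγ j hj, hδ j hj]

lemma notMem_headFreq_of_mem_lastFreq {k l : ℕ} (h : k < l) {γ : Freq G} (hγ : γ ∈ lastFreq G l) :
    γ ∉ headFreq G k := fun h' => hγ.2 (by omega) (h' _ (by omega))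

lemma notMem_headFreq_of_mem_tailFreq {k : ℕ} {γ : Freq G} (hγ : γ ∈ tailFreq G k) :
    γ ∉ headFreq G k := fun h => hγ.2 <| Finsupp.ext fun j =>
  (lt_or_ge j k).elim (hγ.1 j) (h j)

/-- Frequencies that vanish on the first `k` coordinates are determined by their class modulo the
frequencies living on the first `k` coordinates. -/
lemma eq_of_sub_mem_headFreq {k : ℕ} {γ δ : Freq G} (hγ : γ ∈ tailFreq G k)
    (hδ : δ ∈ tailFreq G k) (h : γ - δ ∈ headFreq G k) : γ = δ := by
  by_contra hne
  exact notMem_headFreq_of_mem_tailFreq (γ := γ - δ)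
    ⟨fun j hj => by simp [hγ.1 j hj, hδ.1 j hj], sub_ne_zero.2 hne⟩ h

/-- The level of a frequency: the number of coordinates it needs. It is the unique `k` for which
the frequency belongs to `lastFreq G k`. -/
def level (γ : Freq G) : ℕ := γ.support.sup Nat.succ

lemma mem_headFreq_iff_level_le {k : ℕ} {γ : Freq G} : γ ∈ headFreq G k ↔ level γ ≤ k := by
  simp only [headFreq, level, Set.mem_ofPred_eq, Finset.sup_le_iff, Finsupp.mem_support_iff]
  refine forall_congr' fun j => ?_
  rw [← not_imp_not, Nat.succ_le_iff, not_le]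

lemma mem_lastFreq_iff_level_eq {k : ℕ} {γ : Freq G} : γ ∈ lastFreq G k ↔ level γ = k := by
  constructor
  · intro h
    refine le_antisymm (mem_headFreq_iff_level_le.1 h.1) ?_
    by_contra hlt
    exact notMem_headFreq_of_mem_lastFreq (not_le.1 hlt) h (mem_headFreq_iff_level_le.2 le_rfl)
  · rintro rfl
    refine ⟨mem_headFreq_iff_level_le.2 le_rfl, fun hpos h0 => ?_⟩
    have : γ ∈ headFreq G (level γ - 1) := by
      intro j hj
      rcases hj.eq_or_lt with rfl | hj
      · exact h0
      · exact mem_headFreq_iff_level_le.2 le_rfl j (by omega)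
    have := mem_headFreq_iff_level_le.1 this
    omega

/-- Every frequency splits at `k` into a head in `Γ^k` and a tail vanishing on the first `k`
coordinates; the tail is nonzero once the level exceeds `k`. -/
lemma exists_head_add_tail {k : ℕ} {γ : Freq G} (h : k < level γ) :
    ∃ η ∈ headFreq G k, ∃ γ' ∈ tailFreq G k, γ = η + γ' := by
  classical
  refine ⟨γ.filter (· < k), fun j hj => Finsupp.filter_apply_neg _ _ (not_lt.2 hj),
    γ.filter (fun j => ¬ j < k), ⟨fun j hj => Finsupp.filter_apply_neg _ _ (not_not.2 hj),
      fun h0 => ?_⟩, (Finsupp.filter_add_filter_not _ _).symm⟩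
  refine h.not_ge (mem_headFreq_iff_level_le.1 fun j hj => ?_)
  have := DFunLike.congr_fun h0 j
  rwa [Finsupp.filter_apply_pos (fun j => ¬ j < k) _ (not_lt.2 hj)] at this

lemma add_eq_add_iff {k : ℕ} {η₁ η₂ γ₁ γ₂ : Freq G} (hη₁ : η₁ ∈ headFreq G k)
    (hη₂ : η₂ ∈ headFreq G k) (hγ₁ : γ₁ ∈ tailFreq G k) (hγ₂ : γ₂ ∈ tailFreq G k)
    (h : η₁ + γ₁ = η₂ + γ₂) : η₁ = η₂ ∧ γ₁ = γ₂ := by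
  have : γ₁ = γ₂ := eq_of_sub_mem_headFreq hγ₁ hγ₂ <| by
    rw [show γ₁ - γ₂ = η₂ - η₁ by rw [sub_eq_sub_iff_add_eq_add, add_comm, h]]
    exact sub_mem_headFreq hη₂ hη₁
  subst this
  exact ⟨add_right_cancel h, rfl⟩

variable [MeasurableSpace G] [BorelSpace G]

lemma stronglyMeasurable_character {k : ℕ} {γ : Freq G} (hγ : γ ∈ headFreq G k) :
    StronglyMeasurable[canonicalSigma G k] (character γ) := by
  suffices h : Measurable[canonicalSigma G k] (character γ) from h.stronglyMeasurable
  have : character γ = fun x => ∏ j ∈ γ.support, (((Additive.toMul (γ j)) (x j) : Circle) : ℂ) := by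
    ext x
    simp only [character, Finsupp.prod]
    exact map_prod Circle.coeHom _ _
  rw [this]
  refine Finset.measurable_fun_prod _ fun j hj => ?_
  have hjk : j < k := by
    by_contra h
    exact (Finsupp.mem_support_iff.1 hj) (hγ j (not_lt.1 h))
  have h1 : Measurable fun t : G => (((Additive.toMul (γ j)) t : Circle) : ℂ) :=
    (continuous_subtype_val.comp (map_continuous (Additive.toMul (γ j)))).measurable
  exact h1.comp (measurable_cylinderEvent_apply (Δ := Set.Iio k) hjk)

lemma measurable_character (γ : Freq G) : Measurable (character γ) :=
  ((stronglyMeasurable_character (mem_headFreq_iff_level_le.2 le_rfl)).mono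
    (canonicalSigma_le _)).measurable

end Characters

/-! ### Orthogonality by translation invariance -/

section Orthogonality

variable {G : Type*} [CommGroup G] [MeasurableSpace G]
  {E : Type*} [NormedAddCommGroup E] [NormedSpace ℂ E]

instance (μ : Measure G) [IsProbabilityMeasure μ] : IsProbabilityMeasure (prodMeasure μ) := by
  unfold prodMeasure; infer_instance

variable [TopologicalSpace G] [IsTopologicalGroup G] [BorelSpace G]

instance (μ : Measure G) [IsProbabilityMeasure μ] [μ.IsMulLeftInvariant] :
    (prodMeasure μ).IsMulLeftInvariant := by
  refine ⟨fun t => ?_⟩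
  have := Measure.infinitePi_map_pi (fun _ : ℕ => μ) (f := fun i y => t i * y)
    (fun i => measurable_const_mul (t i))
  simp only [map_mul_left_eq_self] at this
  exact this

variable (μ : Measure G) [IsProbabilityMeasure μ] [μ.IsMulLeftInvariant]

/-- A character that sees a coordinate beyond the first `m` is orthogonal to every function of the
first `m` coordinates: translating that coordinate multiplies the integral by a scalar other
than `1`. -/
lemma integral_character_smul_eq_zero {m : ℕ} {γ : Freq G} (hγ : γ ∉ headFreq G m)
    {g : (ℕ → G) → E} (hg : DependsOn g (Set.Iio m)) :
    ∫ x, character γ x • g x ∂(prodMeasure μ) = 0 := by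
  obtain ⟨j, hj, hγj⟩ : ∃ j, m ≤ j ∧ γ j ≠ 0 := by simpa [headFreq] using hγ
  obtain ⟨t, ht⟩ : ∃ t : G, (Additive.toMul (γ j)) t ≠ 1 := by
    by_contra! h
    exact hγj (Additive.toMul.injective (PontryaginDual.ext h))
  have key := integral_mul_left_eq_self (μ := prodMeasure μ) (fun x => character γ x • g x)
    (Pi.mulSingle j t)
  have hgt : ∀ x, g (Pi.mulSingle j t * x) = g x := fun x => hg fun i hi => by
    rw [Pi.mul_apply, Pi.mulSingle_eq_of_ne (ne_of_lt (lt_of_lt_of_le hi hj)), one_mul]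
  simp only [character_mul, hgt, mul_smul, character_mulSingle] at key
  rw [integral_smul] at key
  by_contra hne
  have h1 : ((((Additive.toMul (γ j)) t : Circle) : ℂ) - 1) •
      ∫ x, character γ x • g x ∂(prodMeasure μ) = 0 := by
    rw [sub_smul, one_smul, key, sub_self]
  rcases smul_eq_zero.1 h1 with h | h
  · exact ht (Circle.ext (by simpa using sub_eq_zero.1 h))
  · exact hne h

/-- Since `1_A g` depends on the first `max m j` coordinates for `A` in `ℱ_j`, all integrals
defining the conditional expectation vanish. -/
lemma condExp_character_smul_eq_zero [CompleteSpace E] {m j : ℕ} {γ : Freq G}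
    (hγ : γ ∉ headFreq G (max m j)) {g : (ℕ → G) → E} (hg : DependsOn g (Set.Iio m))
    (hint : Integrable g (prodMeasure μ)) :
    (prodMeasure μ)[fun x => character γ x • g x | canonicalSigma G j] =ᵐ[prodMeasure μ] 0 := by
  refine (ae_eq_condExp_of_forall_setIntegral_eq (canonicalSigma_le j) ?_
    (fun s _ _ => (integrable_zero _ _ _).integrableOn) (fun s hs _ => ?_)
    aestronglyMeasurable_zero).symm
  · exact hint.bdd_smul 1 (measurable_character γ).aestronglyMeasurable
      (.of_forall fun x => (norm_character γ x).le)
  · have hdep : DependsOn (s.indicator g) (Set.Iio (max m j)) := by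
      have h1 := dependsOn_of_stronglyMeasurable
        ((@stronglyMeasurable_const _ _ (canonicalSigma G j) _ (1 : ℝ)).indicator hs)
      intro x y hxy
      have h1' := h1 (x := x) (y := y) fun i hi => hxy i (Set.mem_Iio.2 (lt_max_of_lt_right hi))
      have h2' := hg (x := x) (y := y) fun i hi => hxy i (Set.mem_Iio.2 (lt_max_of_lt_left hi))
      by_cases hx : x ∈ s <;> by_cases hy : y ∈ s <;> simp_all
    rw [← integral_indicator (canonicalSigma_le j s hs),
      ← integral_indicator (canonicalSigma_le j s hs)]
    have : s.indicator (fun x => character γ x • g x) =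
        fun x => character γ x • s.indicator g x := by
      ext x; by_cases hx : x ∈ s <;> simp [hx]
    rw [this, integral_character_smul_eq_zero μ hγ hdep]
    simp

end Orthogonality

/-! ### Fourier coefficients of martingale differences -/

section Martingale

variable {G : Type*} [MeasurableSpace G] {S : Type*} (μ : Measure G) [IsProbabilityMeasure μ]

lemma stronglyMeasurable_martDiff (f : (ℕ → G) → Hil S) (k : ℕ) :
    StronglyMeasurable[canonicalSigma G k] (martDiff μ f k) := by
  cases k with
  | zero => exact stronglyMeasurable_condExp
  | succ k =>
    exact stronglyMeasurable_condExp.sub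
      (stronglyMeasurable_condExp.mono (canonicalSigma_mono k.le_succ))

lemma integrable_martDiff (f : (ℕ → G) → Hil S) (k : ℕ) :
    Integrable (martDiff μ f k) (prodMeasure μ) := by
  cases k with
  | zero => exact integrable_condExp
  | succ k => exact integrable_condExp.sub integrable_condExp

variable [CommGroup G] [TopologicalSpace G] [BorelSpace G]

lemma integrable_character_smul {E : Type*} [NormedAddCommGroup E] [NormedSpace ℂ E]
    {f : (ℕ → G) → E} (hf : Integrable f (prodMeasure μ)) (γ : Freq G) :
    Integrable (fun x => character γ x • f x) (prodMeasure μ) :=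
  hf.bdd_smul 1 (measurable_character γ).aestronglyMeasurable
      (.of_forall fun x => (norm_character γ x).le)

/-- A frequency living on the first `k` coordinates does not distinguish `f` from
`E(f | ℱ_k)`. -/
lemma integral_character_smul_condExp {E : Type*} [NormedAddCommGroup E] [NormedSpace ℂ E]
    [CompleteSpace E] {f : (ℕ → G) → E} (hf : Integrable f (prodMeasure μ)) {k : ℕ} {γ : Freq G}
    (hγ : γ ∈ headFreq G k) :
    ∫ x, character γ x • ((prodMeasure μ)[f | canonicalSigma G k]) x ∂(prodMeasure μ) =
      ∫ x, character γ x • f x ∂(prodMeasure μ) := by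
  have h := condExp_bilin_of_stronglyMeasurable_left (m := canonicalSigma G k)
    (μ := prodMeasure μ) (ContinuousLinearMap.lsmul ℝ ℂ : ℂ →L[ℝ] E →L[ℝ] E)
    (stronglyMeasurable_character hγ) (g := f) (integrable_character_smul μ hf γ) hf
  calc _ = ∫ x, ((prodMeasure μ)[fun ω => character γ ω • f ω | canonicalSigma G k]) x
        ∂(prodMeasure μ) := (integral_congr_ae h).symm
    _ = _ := integral_condExp (canonicalSigma_le k)

variable [IsTopologicalGroup G] [μ.IsMulLeftInvariant]

lemma fourierCoefficient_eq_integral_martDiff {f : (ℕ → G) → Hil S}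
    (hf : Integrable f (prodMeasure μ)) {k : ℕ} {γ : Freq G} (hγ : γ ∈ lastFreq G k) :
    fourierCoefficient μ f γ = ∫ x, character (-γ) x • martDiff μ f k x ∂(prodMeasure μ) := by
  have hneg : -γ ∈ headFreq G k := neg_mem_headFreq.2 hγ.1
  simp only [fourierCoefficient, ← character_neg]
  refine (integral_character_smul_condExp μ hf hneg).symm.trans ?_
  cases k with
  | zero => rfl
  | succ k =>
    have h0 : ∫ x, character (-γ) x • ((prodMeasure μ)[f | canonicalSigma G k]) x
        ∂(prodMeasure μ) = 0 :=
      integral_character_smul_eq_zero μ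
        (fun h => notMem_headFreq_of_mem_lastFreq k.lt_succ_self hγ (neg_mem_headFreq.1 h))
        (dependsOn_of_stronglyMeasurable stronglyMeasurable_condExp)
    simp only [martDiff, Pi.sub_apply, smul_sub]
    rw [integral_sub (integrable_character_smul μ integrable_condExp _)
      (integrable_character_smul μ integrable_condExp _), h0, sub_zero]
    rfl

end Martingale

/-! ### The Fefferman–Garsia inequality -/

section Garsia

/-- The square function of the first `k` terms of a sequence. -/
noncomputable def partialSquare (u : ℕ → ℝ) (k : ℕ) : ℝ := √(∑ j ∈ Finset.range k, u j ^ 2)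

lemma partialSquare_zero (u : ℕ → ℝ) : partialSquare u 0 = 0 := by simp [partialSquare]

lemma partialSquare_nonneg (u : ℕ → ℝ) (k : ℕ) : 0 ≤ partialSquare u k := Real.sqrt_nonneg _

lemma partialSquare_sq (u : ℕ → ℝ) (k : ℕ) :
    partialSquare u k ^ 2 = ∑ j ∈ Finset.range k, u j ^ 2 :=
  Real.sq_sqrt (Finset.sum_nonneg fun _ _ => sq_nonneg _)

lemma partialSquare_le_succ (u : ℕ → ℝ) (k : ℕ) : partialSquare u k ≤ partialSquare u (k + 1) :=
  Real.sqrt_le_sqrt <| by rw [Finset.sum_range_succ]; nlinarith [sq_nonneg (u k)]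

lemma partialSquare_le_sum_abs (u : ℕ → ℝ) (k : ℕ) :
    partialSquare u k ≤ ∑ j ∈ Finset.range k, |u j| := by
  refine Real.sqrt_le_iff.2 ⟨Finset.sum_nonneg fun _ _ => abs_nonneg _, ?_⟩
  calc _ = ∑ j ∈ Finset.range k, |u j| ^ 2 := by simp
    _ ≤ _ := Finset.sum_sq_le_sq_sum_of_nonneg fun _ _ => abs_nonneg _

/-- With `s_k` the square function of `u` up to and including `k`, the arithmetic-geometric mean
inequality gives `2 B u_k v_k ≤ B² u_k² / s_k + s_k v_k²`, while `u_k² = s_k² - s_{k-1}²` is at most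
`2 s_k (s_k - s_{k-1})`. -/
lemma two_mul_mul_le_increment (u : ℕ → ℝ) (k : ℕ) (v B : ℝ) :
    2 * B * (u k * v) ≤ 2 * B ^ 2 * (partialSquare u (k + 1) - partialSquare u k) +
      partialSquare u (k + 1) * v ^ 2 := by
  have h1 := partialSquare_sq u k
  have h2 := partialSquare_sq u (k + 1)
  rw [Finset.sum_range_succ, ← h1] at h2
  have h3 := partialSquare_le_succ u k
  have h4 := partialSquare_nonneg u k
  generalize partialSquare u (k + 1) = s at *
  generalize partialSquare u k = r at *
  rcases (h4.trans h3).eq_or_lt with hs | hs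
  · have : u k = 0 := by
      subst hs
      nlinarith [sq_nonneg (u k), sq_nonneg r]
    rw [this]
    have : 0 ≤ 2 * B ^ 2 * (s - r) := by have := sub_nonneg.2 h3; positivity
    rw [← hs]
    rw [← hs] at this
    linarith
  · refine le_of_mul_le_mul_left ?_ hs
    nlinarith [sq_nonneg (B * u k - s * v), mul_nonneg (sq_nonneg B) (sq_nonneg (s - r))]

/-- Summation by parts of the previous bound: the weights `s_k` are written as sums of the
nonnegative increments `s_j - s_{j-1}`. -/
lemma two_mul_sum_mul_le (u v : ℕ → ℝ) (B : ℝ) (N : ℕ) :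
    2 * B * ∑ k ∈ Finset.range N, u k * v k ≤ 2 * B ^ 2 * partialSquare u N +
      ∑ j ∈ Finset.range N, ∑ k ∈ Finset.Ico j N,
        (partialSquare u (j + 1) - partialSquare u j) * v k ^ 2 := by
  have htel : ∀ n, partialSquare u n =
      ∑ j ∈ Finset.range n, (partialSquare u (j + 1) - partialSquare u j) := fun n => by
    rw [Finset.sum_range_sub, partialSquare_zero, sub_zero]
  have hswap : ∑ j ∈ Finset.range N, ∑ k ∈ Finset.Ico j N,
        (partialSquare u (j + 1) - partialSquare u j) * v k ^ 2 =
      ∑ k ∈ Finset.range N, partialSquare u (k + 1) * v k ^ 2 := by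
    rw [Finset.sum_comm' (t' := Finset.range N) (s' := fun k => Finset.range (k + 1))
      (by intro x y; simp only [Finset.mem_range, Finset.mem_Ico]; omega)]
    refine Finset.sum_congr rfl fun k _ => ?_
    rw [← Finset.sum_mul, ← htel]
  rw [hswap, htel N, Finset.mul_sum, Finset.mul_sum, ← Finset.sum_add_distrib]
  exact Finset.sum_le_sum fun k _ => two_mul_mul_le_increment u k (v k) B

/-- The Fefferman–Garsia inequality between `H¹` and `BMO`: if the conditional expectations
`E(∑_{k ≥ j} v_k² | ℱ_j)` are at most `B²`, which is expressed by testing against nonnegative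
`ℱ_j`-measurable weights, then an adapted sequence `u` satisfies
`∑ E(u_k v_k) ≤ (3/2) B E(∑ u_k²)^{1/2}`. -/
lemma sum_integral_mul_le {Ω : Type*} {m0 : MeasurableSpace Ω} (P : Measure Ω)
    {F : ℕ → MeasurableSpace Ω} (hF : ∀ k, F k ≤ m0) (hmono : Monotone F) {u v : ℕ → Ω → ℝ}
    (hu : ∀ k, StronglyMeasurable[F k] (u k)) (hui : ∀ k, Integrable (u k) P)
    (hv : ∀ k, AEStronglyMeasurable (v k) P) (hvb : ∀ k, ∃ M, ∀ x, ‖v k x‖ ≤ M)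
    (N : ℕ) {B : ℝ} (hB : 0 < B)
    (hbmo : ∀ j, ∀ w : Ω → ℝ, StronglyMeasurable[F j] w → Integrable w P → (∀ x, 0 ≤ w x) →
      ∑ k ∈ Finset.Ico j N, ∫ x, w x * v k x ^ 2 ∂P ≤ B ^ 2 * ∫ x, w x ∂P) :
    ∑ k ∈ Finset.range N, ∫ x, u k x * v k x ∂P ≤
      3 / 2 * B * ∫ x, partialSquare (fun k => u k x) N ∂P := by
  have hsm : ∀ n j, (∀ i < n, i ≤ j) →
      StronglyMeasurable[F j] fun x => partialSquare (fun k => u k x) n := by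
    intro n j hn
    refine Real.continuous_sqrt.comp_stronglyMeasurable
      (Finset.stronglyMeasurable_fun_sum _ fun i hi => ?_)
    exact ((hu i).mono (hmono (hn i (Finset.mem_range.1 hi)))).pow 2
  have hsi : ∀ n, Integrable (fun x => partialSquare (fun k => u k x) n) P := by
    intro n
    refine Integrable.mono' (integrable_finsetSum (Finset.range n) fun i _ => (hui i).abs)
      ((hsm n n fun i hi => hi.le).mono (hF n)).aestronglyMeasurable (.of_forall fun x => ?_)
    rw [Real.norm_of_nonneg (partialSquare_nonneg _ _)]
    exact partialSquare_le_sum_abs _ _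
  set δ : ℕ → Ω → ℝ := fun j x =>
    partialSquare (fun k => u k x) (j + 1) - partialSquare (fun k => u k x) j with hδ
  have hδi : ∀ j, Integrable (δ j) P := fun j => (hsi _).sub (hsi _)
  have hδv : ∀ j k, Integrable (fun x => δ j x * v k x ^ 2) P := by
    intro j k
    obtain ⟨M, hM⟩ := hvb k
    refine (hδi j).mul_bdd (c := M ^ 2) ((hv k).pow 2) (.of_forall fun x => ?_)
    rw [norm_pow]
    exact pow_le_pow_left₀ (norm_nonneg _) (hM x) 2
  have huv : ∀ k, Integrable (fun x => u k x * v k x) P := by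
    intro k
    obtain ⟨M, hM⟩ := hvb k
    exact (hui k).mul_bdd (c := M) (hv k) (.of_forall hM)
  have hint : ∫ x, 2 * B * ∑ k ∈ Finset.range N, u k x * v k x ∂P ≤
      ∫ x, (2 * B ^ 2 * partialSquare (fun k => u k x) N +
        ∑ j ∈ Finset.range N, ∑ k ∈ Finset.Ico j N, δ j x * v k x ^ 2) ∂P :=
    integral_mono ((integrable_finsetSum _ fun k _ => huv k).const_mul _)
      (((hsi N).const_mul _).add (integrable_finsetSum _ fun j _ =>
        integrable_finsetSum _ fun k _ => hδv j k))
      fun x => two_mul_sum_mul_le (fun k => u k x) (fun k => v k x) B N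
  rw [integral_const_mul, integral_finsetSum _ fun k _ => huv k,
    integral_add ((hsi N).const_mul _) (integrable_finsetSum _ fun j _ =>
        integrable_finsetSum _ fun k _ => hδv j k), integral_const_mul,
    integral_finsetSum _ fun j _ => integrable_finsetSum _ fun k _ => hδv j k] at hint
  have htail : ∑ j ∈ Finset.range N, ∫ x, ∑ k ∈ Finset.Ico j N, δ j x * v k x ^ 2 ∂P ≤
      B ^ 2 * ∫ x, partialSquare (fun k => u k x) N ∂P := by
    calc _ ≤ ∑ j ∈ Finset.range N, B ^ 2 * ∫ x, δ j x ∂P := by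
          refine Finset.sum_le_sum fun j _ => ?_
          rw [integral_finsetSum _ fun k _ => hδv j k]
          exact hbmo j (δ j) ((hsm _ _ fun i hi => by omega).sub (hsm _ _ fun i hi => hi.le))
            (hδi j) fun x => sub_nonneg.2 (partialSquare_le_succ _ _)
      _ = B ^ 2 * ∫ x, partialSquare (fun k => u k x) N ∂P := by
          rw [← Finset.mul_sum, ← integral_finsetSum _ fun j _ => hδi j]
          simp only [hδ, Finset.sum_range_sub, partialSquare_zero, sub_zero]
  refine le_of_mul_le_mul_left ?_ (show 0 < 2 * B by positivity)
  nlinarith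

lemma integral_partialSquare_le_hardyNorm {G : Type*} [MeasurableSpace G] {S : Type*}
    (μ : Measure G) [IsProbabilityMeasure μ] (f : (ℕ → G) → Hil S) (N : ℕ) :
    ENNReal.ofReal (∫ x, partialSquare (fun k => ‖martDiff μ f k x‖) N ∂(prodMeasure μ)) ≤
      hardyNorm μ f := by
  refine (Real.ofReal_le_enorm _).trans <| (enorm_integral_le_lintegral_enorm _).trans <|
    lintegral_mono fun x => ?_
  rw [Real.enorm_of_nonneg (partialSquare_nonneg _ _), partialSquare, Real.sqrt_eq_rpow,
    ← ENNReal.ofReal_rpow_of_nonneg (Finset.sum_nonneg fun _ _ => sq_nonneg _) (by norm_num)]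
  refine ENNReal.rpow_le_rpow ?_ (by norm_num)
  rw [ENNReal.ofReal_sum_of_nonneg fun _ _ => sq_nonneg _]
  simp_rw [ENNReal.ofReal_pow (norm_nonneg _), ofReal_norm]
  exact ENNReal.sum_le_tsum _

end Garsia

/-! ### Pairs of frequencies and the two suprema -/

section Pairs

lemma sum_le_tsum_of_subset_range {Y Z : Type*} {Φ : Z → Y} {T : Finset Y}
    (hT : ∀ y ∈ T, ∃ z, Φ z = y) (h : Y → ℝ≥0∞) : ∑ y ∈ T, h y ≤ ∑' z, h (Φ z) := by
  choose ψ hψ using hT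
  have hinj : Function.Injective fun y : {y // y ∈ T} => ψ y y.2 := fun y₁ y₂ h12 =>
    Subtype.ext (by rw [← hψ y₁ y₁.2, ← hψ y₂ y₂.2]; exact congrArg Φ h12)
  rw [← Finset.tsum_subtype]
  calc _ = ∑' y : {y // y ∈ T}, h (Φ (ψ y y.2)) := by simp only [hψ]
    _ ≤ _ := ENNReal.tsum_comp_le_tsum_of_injective hinj fun z => h (Φ z)

lemma sq_tsum_eq_tsum_prod {ι : Type*} (f : ι → ℝ≥0∞) :
    (∑' i, f i) ^ 2 = ∑' z : ι × ι, f z.1 * f z.2 := by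
  rw [sq, ← ENNReal.tsum_mul_right, ENNReal.tsum_prod']
  simp_rw [ENNReal.tsum_mul_left]

variable {G : Type*} [CommGroup G] [TopologicalSpace G] {S : Type*} (lam : Freq G → S → ℝ≥0)

lemma le_tailTerm_sq (k : ℕ) : (∑' γ' : tailFreq G k, ∑' s : S,
    (∑' γ : headFreq G k, (lam ((γ : Freq G) + (γ' : Freq G)) s : ℝ≥0∞)) ^ 2) ≤
      tailTerm lam ^ 2 := by
  rw [← ENNReal.rpow_natCast, ← ENNReal.rpow_inv_le_iff (by norm_num)]
  refine le_of_eq_of_le ?_ (le_iSup _ k)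
  norm_num

lemma le_lastTerm_sq (k : ℕ) :
    (∑' s : S, (∑' γ : lastFreq G k, (lam (γ : Freq G) s : ℝ≥0∞)) ^ 2) ≤ lastTerm lam ^ 2 := by
  rw [← ENNReal.rpow_natCast, ← ENNReal.rpow_inv_le_iff (by norm_num)]
  refine le_of_eq_of_le ?_ (le_iSup _ k)
  norm_num

open Classical in
/-- The pairs of indices from `F` whose frequencies have level `k`, whose `S`-components agree, and
whose frequencies differ by an element of `Γ^j` only. -/
noncomputable def levelPairs (F : Finset (Freq G × S)) (j k : ℕ) :
    Finset ((Freq G × S) × (Freq G × S)) :=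
  (F ×ˢ F).filter fun z => level z.1.1 = k ∧ level z.2.1 = k ∧ z.1.2 = z.2.2 ∧
    z.2.1 - z.1.1 ∈ headFreq G j

lemma sum_levelPairs_self_le (F : Finset (Freq G × S)) (j : ℕ) :
    ∑ z ∈ levelPairs F j j, (lam z.1.1 z.1.2 * lam z.2.1 z.2.2 : ℝ≥0∞) ≤ lastTerm lam ^ 2 := by
  refine le_trans ?_ (le_lastTerm_sq lam j)
  simp_rw [sq_tsum_eq_tsum_prod]
  rw [← ENNReal.tsum_prod (f := fun (s : S) (y : lastFreq G j × lastFreq G j) =>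
    (lam y.1 s * lam y.2 s : ℝ≥0∞))]
  refine sum_le_tsum_of_subset_range (Z := S × lastFreq G j × lastFreq G j)
    (Φ := fun y => (((y.2.1 : Freq G), y.1), ((y.2.2 : Freq G), y.1))) ?_
    fun z => (lam z.1.1 z.1.2 * lam z.2.1 z.2.2 : ℝ≥0∞)
  rintro ⟨⟨γ₁, s₁⟩, ⟨γ₂, s₂⟩⟩ hz
  simp only [levelPairs, Finset.mem_filter] at hz
  obtain ⟨-, h1, h2, rfl, -⟩ := hz
  exact ⟨(s₁, ⟨γ₁, mem_lastFreq_iff_level_eq.2 h1⟩, ⟨γ₂, mem_lastFreq_iff_level_eq.2 h2⟩), rfl⟩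

lemma sum_levelPairs_le_tailTerm (F : Finset (Freq G × S)) (j N : ℕ) :
    ∑ k ∈ Finset.Ico (j + 1) N, ∑ z ∈ levelPairs F j k,
      (lam z.1.1 z.1.2 * lam z.2.1 z.2.2 : ℝ≥0∞) ≤ tailTerm lam ^ 2 := by
  classical
  refine le_trans ?_ (le_tailTerm_sq lam j)
  rw [← Finset.sum_biUnion]
  swap
  · intro k _ l _ hkl
    refine Finset.disjoint_left.2 fun z hz hz' => hkl ?_
    simp only [levelPairs, Finset.mem_filter] at hz hz'
    exact hz.2.1.symm.trans hz'.2.1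
  simp_rw [sq_tsum_eq_tsum_prod]
  simp_rw [← ENNReal.tsum_prod]
  refine sum_le_tsum_of_subset_range (Z := tailFreq G j × S × headFreq G j × headFreq G j)
    (Φ := fun y => (((y.2.2.1 + y.1 : Freq G), y.2.1), ((y.2.2.2 + y.1 : Freq G), y.2.1))) ?_
    fun z => (lam z.1.1 z.1.2 * lam z.2.1 z.2.2 : ℝ≥0∞)
  rintro ⟨⟨γ₁, s₁⟩, ⟨γ₂, s₂⟩⟩ hz
  simp only [levelPairs, Finset.mem_biUnion, Finset.mem_Ico, Finset.mem_filter] at hz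
  obtain ⟨k, ⟨hk, -⟩, -, h1, h2, rfl, h3⟩ := hz
  obtain ⟨η, hη, γ', hγ', rfl⟩ := exists_head_add_tail (k := j) (γ := γ₁) (by omega)
  have hη₂ : γ₂ - γ' ∈ headFreq G j := fun i hi => by
    have e1 := h3 i hi
    have e2 := hη i hi
    simp only [Finsupp.sub_apply, Finsupp.add_apply, e2, zero_add] at e1 ⊢
    exact e1
  exact ⟨(⟨γ', hγ'⟩, s₁, ⟨η, hη⟩, ⟨_, hη₂⟩), by simp⟩

/-- The `BMO` norm of every polynomial with coefficients bounded by `lam` is controlled by the sum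
of the two suprema: the terms of level `j` are controlled by the second one, the terms of higher
level by the first. -/
lemma sum_levelPairs_le (F : Finset (Freq G × S)) (j N : ℕ) :
    ∑ k ∈ Finset.Ico j N, ∑ z ∈ levelPairs F j k,
      (lam z.1.1 z.1.2 * lam z.2.1 z.2.2 : ℝ≥0∞) ≤ (tailTerm lam + lastTerm lam) ^ 2 := by
  rcases lt_or_ge j N with h | h
  · rw [Finset.sum_eq_sum_Ico_succ_bot h]
    calc _ ≤ lastTerm lam ^ 2 + tailTerm lam ^ 2 :=
          add_le_add (sum_levelPairs_self_le lam F j) (sum_levelPairs_le_tailTerm lam F j N)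
      _ ≤ lastTerm lam ^ 2 + tailTerm lam ^ 2 + 2 * tailTerm lam * lastTerm lam := le_self_add
      _ = _ := by ring
  · simp [Finset.Ico_eq_empty_of_le h]

end Pairs

/-! ### The upper bound -/

section Upper

variable {G : Type*} [CommGroup G] [TopologicalSpace G] {S : Type*}

open Classical in
/-- The standard unit vector `e_s` of `ℓ²(S)`. -/
noncomputable def unitVector (s : S) : Hil S := lp.single 2 s 1

lemma inner_unitVector_left (s : S) (v : Hil S) : inner ℂ (unitVector s) v = v s := by
  classical
  rw [unitVector, lp.inner_single_left]
  simp

open Classical in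
lemma unitVector_apply (s t : S) : unitVector s t = if t = s then (1 : ℂ) else 0 := by
  rw [unitVector, lp.single_apply, Pi.single_apply]

/-- The part of level `k` of the polynomial `∑ a_{γ,s} γ(x) e_s`, summed over `(γ, s)` in `F`. -/
noncomputable def levelPoly (F : Finset (Freq G × S)) (a : Freq G × S → ℂ) (k : ℕ) (x : ℕ → G) :
    Hil S :=
  ∑ p ∈ F with level p.1 = k, (a p * character p.1 x) • unitVector p.2

open Classical in
lemma norm_levelPoly_sq (F : Finset (Freq G × S)) (a : Freq G × S → ℂ) (k : ℕ) (x : ℕ → G) :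
    ((‖levelPoly F a k x‖ ^ 2 : ℝ) : ℂ) = ∑ p ∈ F with level p.1 = k, ∑ q ∈ F with level q.1 = k,
      if p.2 = q.2 then starRingEnd ℂ (a p) * a q * character (q.1 - p.1) x else 0 := by
  have h := inner_self_eq_norm_sq_to_K (𝕜 := ℂ) (levelPoly F a k x)
  push_cast
  refine h.symm.trans ?_
  rw [levelPoly, sum_inner]
  refine Finset.sum_congr rfl fun p _ => ?_
  rw [inner_sum]
  refine Finset.sum_congr rfl fun q _ => ?_
  rw [inner_smul_left, inner_smul_right, inner_unitVector_left, unitVector_apply, map_mul,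
    ← character_neg, sub_eq_add_neg, character_add]
  split_ifs
  · ring
  · ring

lemma norm_levelPoly_le (F : Finset (Freq G × S)) (a : Freq G × S → ℂ) (k : ℕ) (x : ℕ → G) :
    ‖levelPoly F a k x‖ ≤ ∑ p ∈ F with level p.1 = k, ‖a p‖ * ‖unitVector p.2‖ := by
  refine (norm_sum_le _ _).trans (Finset.sum_le_sum fun p _ => ?_)
  rw [norm_smul, norm_mul, norm_character, mul_one]

variable [MeasurableSpace G] [BorelSpace G]

lemma stronglyMeasurable_levelPoly (F : Finset (Freq G × S)) (a : Freq G × S → ℂ) (k : ℕ) :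
    StronglyMeasurable (levelPoly F a k) :=
  Finset.stronglyMeasurable_fun_sum _ fun p _ =>
    ((measurable_character p.1).stronglyMeasurable.const_mul (a p)).smul_const _

variable (μ : Measure G) [IsProbabilityMeasure μ] [IsTopologicalGroup G] [μ.IsMulLeftInvariant]

/-- Integrating `‖levelPoly‖²` against a nonnegative function of the first `j` coordinates, only the
pairs of frequencies that agree modulo `Γ^j` survive. -/
lemma integral_mul_norm_levelPoly_sq_le (F : Finset (Freq G × S)) {a : Freq G × S → ℂ}
    {lam : Freq G → S → ℝ≥0} (ha : ∀ p, ‖a p‖ ≤ lam p.1 p.2) (j k : ℕ) {w : (ℕ → G) → ℝ}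
    (hw : DependsOn w (Set.Iio j)) (hwi : Integrable w (prodMeasure μ)) (hw0 : ∀ x, 0 ≤ w x) :
    ∫ x, w x * ‖levelPoly F a k x‖ ^ 2 ∂(prodMeasure μ) ≤
      (∑ z ∈ levelPairs F j k, (lam z.1.1 z.1.2 * lam z.2.1 z.2.2 : ℝ)) *
        ∫ x, w x ∂(prodMeasure μ) := by
  classical
  have hwi' : Integrable (fun x => (w x : ℂ)) (prodMeasure μ) := hwi.ofReal
  have hsplit : ((∫ x, w x * ‖levelPoly F a k x‖ ^ 2 ∂(prodMeasure μ) : ℝ) : ℂ) =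
      ∑ p ∈ F with level p.1 = k, ∑ q ∈ F with level q.1 = k,
        if p.2 = q.2 then starRingEnd ℂ (a p) * a q *
          ∫ x, character (q.1 - p.1) x • (w x : ℂ) ∂(prodMeasure μ) else 0 := by
    rw [← integral_complex_ofReal]
    have hpt : ∀ x, ((w x * ‖levelPoly F a k x‖ ^ 2 : ℝ) : ℂ) =
        ∑ p ∈ F with level p.1 = k, ∑ q ∈ F with level q.1 = k,
          (if p.2 = q.2 then starRingEnd ℂ (a p) * a q else 0) *
            (character (q.1 - p.1) x • (w x : ℂ)) := by
      intro x
      rw [Complex.ofReal_mul, norm_levelPoly_sq, Finset.mul_sum]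
      refine Finset.sum_congr rfl fun p _ => ?_
      rw [Finset.mul_sum]
      refine Finset.sum_congr rfl fun q _ => ?_
      split_ifs
      · rw [smul_eq_mul]; ring
      · ring
    simp_rw [hpt]
    have hI : ∀ p q : Freq G × S, Integrable (fun x =>
        (if p.2 = q.2 then starRingEnd ℂ (a p) * a q else 0) *
            (character (q.1 - p.1) x • (w x : ℂ))) (prodMeasure μ) := fun p q =>
      (integrable_character_smul μ hwi' _).const_mul _
    rw [integral_finsetSum _ fun p _ => integrable_finsetSum _ fun q _ => hI p q]
    refine Finset.sum_congr rfl fun p _ => ?_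
    rw [integral_finsetSum _ fun q _ => hI p q]
    refine Finset.sum_congr rfl fun q _ => ?_
    rw [integral_const_mul]
    split_ifs
    · rfl
    · rw [zero_mul]
  have hterm : ∀ p q : Freq G × S, ‖if p.2 = q.2 then starRingEnd ℂ (a p) * a q *
      ∫ x, character (q.1 - p.1) x • (w x : ℂ) ∂(prodMeasure μ) else 0‖ ≤
      if p.2 = q.2 ∧ q.1 - p.1 ∈ headFreq G j then
        (lam p.1 p.2 * lam q.1 q.2 : ℝ) * ∫ x, w x ∂(prodMeasure μ) else 0 := by
    intro p q
    by_cases hs : p.2 = q.2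
    · by_cases hh : q.1 - p.1 ∈ headFreq G j
      · rw [if_pos hs, if_pos ⟨hs, hh⟩, norm_mul, norm_mul, RCLike.norm_conj]
        refine mul_le_mul (mul_le_mul (ha p) (ha q) (norm_nonneg _) (NNReal.coe_nonneg _)) ?_
          (norm_nonneg _) (by positivity)
        refine (norm_integral_le_integral_norm _).trans (le_of_eq ?_)
        refine integral_congr_ae (.of_forall fun x => ?_)
        simp only [norm_smul, norm_character, one_mul, Complex.norm_real,
          Real.norm_of_nonneg (hw0 x)]
      · rw [if_pos hs, if_neg (fun h => hh h.2),
          integral_character_smul_eq_zero μ hh (fun x y hxy => by rw [hw hxy])]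
        simp
    · rw [if_neg hs, if_neg (fun h => hs h.1), norm_zero]
  calc _ ≤ ‖((∫ x, w x * ‖levelPoly F a k x‖ ^ 2 ∂(prodMeasure μ) : ℝ) : ℂ)‖ := by
        rw [Complex.norm_real]; exact Real.le_norm_self _
    _ ≤ ∑ p ∈ F with level p.1 = k, ∑ q ∈ F with level q.1 = k,
        if p.2 = q.2 ∧ q.1 - p.1 ∈ headFreq G j then
          (lam p.1 p.2 * lam q.1 q.2 : ℝ) * ∫ x, w x ∂(prodMeasure μ) else 0 := by
        rw [hsplit]
        exact (norm_sum_le _ _).trans (Finset.sum_le_sum fun p _ =>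
          (norm_sum_le _ _).trans (Finset.sum_le_sum fun q _ => hterm p q))
    _ = _ := by
        rw [← Finset.sum_product', ← Finset.sum_filter, ← Finset.sum_mul]
        congr 1
        refine Finset.sum_congr ?_ fun _ _ => rfl
        ext z
        simp only [levelPairs, Finset.mem_filter, Finset.mem_product]
        tauto

/-- The part of level `k` of the sum to be estimated is the pairing of `Δ_k f` with the part of
level `k` of a polynomial whose coefficients are bounded by `lam`. -/
lemma sum_mul_norm_fourierCoefficient_le_integral {f : (ℕ → G) → Hil S}
    (hf : Integrable f (prodMeasure μ)) (lam : Freq G → S → ℝ≥0) (F : Finset (Freq G × S)) :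
    ∃ a : Freq G × S → ℂ, (∀ p, ‖a p‖ ≤ lam p.1 p.2) ∧ ∀ k,
      ∑ p ∈ F with level p.1 = k, lam p.1 p.2 * ‖fourierCoefficient μ f p.1 p.2‖ ≤
        ∫ x, ‖martDiff μ f k x‖ * ‖levelPoly F a k x‖ ∂(prodMeasure μ) := by
  set z : Freq G × S → ℂ := fun p => fourierCoefficient μ f p.1 p.2 with hz
  -- The coefficient carries the phase of the Fourier coefficient it is paired with.
  refine ⟨fun p => lam p.1 p.2 * (z p / ‖z p‖), fun p => ?_, fun k => ?_⟩
  · rw [norm_mul, norm_div, Complex.norm_real, Complex.norm_real, norm_norm]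
    simpa using mul_le_of_le_one_right (NNReal.coe_nonneg _) (div_self_le_one ‖z p‖)
  set a : Freq G × S → ℂ := fun p => lam p.1 p.2 * (z p / ‖z p‖) with ha
  have hd := integrable_martDiff μ f k
  have hI : ∀ p : Freq G × S, Integrable (fun x =>
      inner ℂ ((a p * character p.1 x) • unitVector p.2) (martDiff μ f k x)) (prodMeasure μ) ∧
      (level p.1 = k → ∫ x, inner ℂ ((a p * character p.1 x) • unitVector p.2) (martDiff μ f k x)
        ∂(prodMeasure μ) = ((lam p.1 p.2 * ‖z p‖ : ℝ) : ℂ)) := by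
    intro p
    have hpt : ∀ x, inner ℂ ((a p * character p.1 x) • unitVector p.2) (martDiff μ f k x) =
        inner ℂ (a p • unitVector p.2) (character (-p.1) x • martDiff μ f k x) := by
      intro x
      rw [inner_smul_left, inner_smul_left, inner_smul_right, map_mul, character_neg]
      ring
    simp_rw [hpt]
    refine ⟨(integrable_character_smul μ hd _).const_inner _, fun hp => ?_⟩
    rw [integral_inner (integrable_character_smul μ hd _), inner_smul_left]
    have h1 := fourierCoefficient_eq_integral_martDiff μ hf (mem_lastFreq_iff_level_eq.2 hp)
    have h2 : inner ℂ (unitVector p.2)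
        (∫ x, character (-p.1) x • martDiff μ f k x ∂(prodMeasure μ)) = z p := by
      rw [inner_unitVector_left, hz]
      simp only [h1]
    rw [h2, ha]
    by_cases h0 : z p = 0
    · simp [h0]
    · have hn : (‖z p‖ : ℂ) ≠ 0 := by simpa using h0
      have hc : starRingEnd ℂ (z p) * z p = (‖z p‖ : ℂ) ^ 2 := by
        rw [mul_comm, Complex.mul_conj, Complex.normSq_eq_norm_sq]; push_cast; rfl
      simp only [map_mul, map_div₀, Complex.conj_ofReal, Complex.ofReal_mul]
      rw [mul_assoc, div_mul_eq_mul_div, hc, sq, mul_div_assoc, div_self hn, mul_one]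
  have hsum : ((∑ p ∈ F with level p.1 = k, lam p.1 p.2 * ‖z p‖ : ℝ) : ℂ) =
      ∫ x, inner ℂ (levelPoly F a k x) (martDiff μ f k x) ∂(prodMeasure μ) := by
    simp only [levelPoly, sum_inner]
    rw [integral_finsetSum _ fun p _ => (hI p).1, Complex.ofReal_sum]
    exact Finset.sum_congr rfl fun p hp => ((hI p).2 (Finset.mem_filter.1 hp).2).symm
  calc _ ≤ ‖((∑ p ∈ F with level p.1 = k, lam p.1 p.2 * ‖z p‖ : ℝ) : ℂ)‖ := by
        rw [Complex.norm_real]; exact Real.le_norm_self _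
    _ ≤ ∫ x, ‖inner ℂ (levelPoly F a k x) (martDiff μ f k x)‖ ∂(prodMeasure μ) := by
        rw [hsum]; exact norm_integral_le_integral_norm _
    _ ≤ _ := by
        refine integral_mono_of_nonneg (.of_forall fun x => norm_nonneg _) ?_
          (.of_forall fun x => ?_)
        · exact hd.norm.mul_bdd (stronglyMeasurable_levelPoly F a k).norm.aestronglyMeasurable
            (.of_forall fun x => (norm_norm _).trans_le (norm_levelPoly_le F a k x))
        · exact (norm_inner_le_norm _ _).trans (mul_comm _ _).le

/-- The finite form of the upper bound: Garsia's inequality for the norms of the martingale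
differences of `f` and of a polynomial with coefficients bounded by `lam`. -/
lemma sum_mul_enorm_fourierCoefficient_le {f : (ℕ → G) → Hil S} (hf : Integrable f (prodMeasure μ))
    {lam : Freq G → S → ℝ≥0} {B : ℝ≥0} (hB : 0 < B) (h : tailTerm lam + lastTerm lam ≤ B)
    (F : Finset (Freq G × S)) :
    ∑ p ∈ F, (lam p.1 p.2 : ℝ≥0∞) * ‖fourierCoefficient μ f p.1 p.2‖ₑ ≤
      ((3 / 2 : ℝ≥0) : ℝ≥0∞) * B * hardyNorm μ f := by
  obtain ⟨a, ha, hle⟩ := sum_mul_norm_fourierCoefficient_le_integral μ hf lam F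
  set N := F.sup (fun p => level p.1) + 1 with hN
  have hbmo : ∀ j, ∑ k ∈ Finset.Ico j N,
      ∑ z ∈ levelPairs F j k, (lam z.1.1 z.1.2 * lam z.2.1 z.2.2 : ℝ) ≤ (B : ℝ) ^ 2 := by
    intro j
    have := (sum_levelPairs_le lam F j N).trans (pow_le_pow_left' h 2)
    exact_mod_cast this
  have hG := sum_integral_mul_le (prodMeasure μ) (F := canonicalSigma G)
    (u := fun k x => ‖martDiff μ f k x‖) (v := fun k x => ‖levelPoly F a k x‖)
    (fun k => canonicalSigma_le k) (fun k l hkl => canonicalSigma_mono hkl)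
    (fun k => (stronglyMeasurable_martDiff μ f k).norm) (fun k => (integrable_martDiff μ f k).norm)
    (fun k => (stronglyMeasurable_levelPoly F a k).norm.aestronglyMeasurable)
    (fun k => ⟨_, fun x => (norm_norm _).trans_le (norm_levelPoly_le F a k x)⟩) N
    (B := B) (by exact_mod_cast hB) (fun j w hw hwi hw0 => by
      refine (Finset.sum_le_sum fun k _ => integral_mul_norm_levelPoly_sq_le μ F ha j k
        (dependsOn_of_stronglyMeasurable hw) hwi hw0).trans ?_
      rw [← Finset.sum_mul]
      exact mul_le_mul_of_nonneg_right (hbmo j) (integral_nonneg hw0))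
  have hreal : ∑ p ∈ F, lam p.1 p.2 * ‖fourierCoefficient μ f p.1 p.2‖ ≤
      3 / 2 * B * ∫ x, partialSquare (fun k => ‖martDiff μ f k x‖) N ∂(prodMeasure μ) := by
    refine le_trans ?_ hG
    rw [← Finset.sum_fiberwise_of_maps_to (s := F) (t := Finset.range N) (g := fun p => level p.1)
      (fun p hp => Finset.mem_range.2 (Nat.lt_succ_of_le
        (Finset.le_sup (f := fun p : Freq G × S => level p.1) hp)))]
    exact Finset.sum_le_sum fun k _ => hle k
  calc _ = ENNReal.ofReal (∑ p ∈ F, lam p.1 p.2 * ‖fourierCoefficient μ f p.1 p.2‖) := by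
        rw [ENNReal.ofReal_sum_of_nonneg fun p _ => by positivity]
        refine Finset.sum_congr rfl fun p _ => ?_
        rw [ENNReal.ofReal_mul (NNReal.coe_nonneg _), ofReal_norm, ENNReal.ofReal_coe_nnreal]
    _ ≤ ENNReal.ofReal ((3 / 2 * B : ℝ≥0) *
          ∫ x, partialSquare (fun k => ‖martDiff μ f k x‖) N ∂(prodMeasure μ)) :=
        ENNReal.ofReal_le_ofReal (by exact_mod_cast hreal)
    _ ≤ _ := by
        rw [ENNReal.ofReal_mul (NNReal.coe_nonneg _), ENNReal.ofReal_coe_nnreal, ENNReal.coe_mul]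
        gcongr
        exact integral_partialSquare_le_hardyNorm μ f N

theorem multiplierNorm_le (lam : Freq G → S → ℝ≥0) :
    multiplierNorm μ lam ≤ ((3 / 2 : ℝ≥0) : ℝ≥0∞) * (tailTerm lam + lastTerm lam) := by
  -- Garsia's inequality needs a positive bound, so the sum of the suprema is approached from above.
  have key : ∀ B : ℝ≥0, 0 < B → tailTerm lam + lastTerm lam ≤ B →
      multiplierNorm μ lam ≤ ((3 / 2 : ℝ≥0) : ℝ≥0∞) * B := by
    intro B hB h
    refine sInf_le fun f hf => ?_
    rw [ENNReal.tsum_eq_iSup_sum]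
    exact iSup_le fun F => sum_mul_enorm_fourierCoefficient_le μ hf.1 hB h F
  rw [← ENNReal.div_le_iff' (by norm_num) ENNReal.coe_ne_top]
  refine le_of_forall_gt_imp_ge_of_dense fun B hB => ?_
  rw [ENNReal.div_le_iff' (by norm_num) ENNReal.coe_ne_top]
  induction B with
  | top => rw [ENNReal.mul_top (by norm_num)]; exact le_top
  | coe B => exact key B (by exact_mod_cast (zero_le).trans_lt hB) hB.le

end Upper

/-! ### Approximate identities -/

section Kernel

lemma lintegral_enorm_eq_one {Ω : Type*} {m : MeasurableSpace Ω} {P : Measure Ω} {K : Ω → ℝ}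
    (hKi : Integrable K P) (hK0 : ∀ x, 0 ≤ K x) (hK1 : ∫ x, K x ∂P = 1) :
    ∫⁻ x, ‖K x‖ₑ ∂P = 1 := by
  rw [← ofReal_integral_norm_eq_lintegral_enorm hKi]
  simp_rw [Real.norm_of_nonneg (hK0 _)]
  rw [hK1, ENNReal.ofReal_one]

lemma enorm_ofReal_coe (r : ℝ≥0) : ‖((r : ℝ) : ℂ)‖ₑ = r := by
  rw [← ofReal_norm, Complex.norm_real, Real.norm_of_nonneg (NNReal.coe_nonneg _),
    ENNReal.ofReal_coe_nnreal]

variable {G : Type*} [CommGroup G] [TopologicalSpace G]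

lemma continuous_character (γ : Freq G) : Continuous (character γ) := by
  have h : Continuous fun x : ℕ → G => (γ.prod fun j χ => (Additive.toMul χ) (x j) : Circle) :=
    continuous_finsetProd _ fun j _ =>
      (map_continuous (Additive.toMul (γ j))).comp (continuous_apply j)
  exact continuous_subtype_val.comp h

lemma character_one (γ : Freq G) : character γ (1 : ℕ → G) = 1 := by
  simp [character]

variable [MeasurableSpace G] [BorelSpace G] (μ : Measure G) [IsProbabilityMeasure μ]

lemma prodMeasure_ne_zero_of_isOpen [μ.IsOpenPosMeasure] {U W : Set (ℕ → G)} (hU : IsOpen U)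
    (h1 : (1 : ℕ → G) ∈ U) (hUW : U ⊆ W) : prodMeasure μ W ≠ 0 := by
  obtain ⟨I, u, hu, hsub⟩ := isOpen_pi_iff.1 hU 1 h1
  refine ne_of_gt (lt_of_lt_of_le ?_ (measure_mono (hsub.trans hUW)))
  rw [prodMeasure, Measure.infinitePi_pi _ fun i hi => (hu i hi).1.measurableSet]
  exact pos_iff_ne_zero.2 (Finset.prod_ne_zero_iff.2 fun i hi =>
    (hu i hi).1.measure_ne_zero μ ⟨_, (hu i hi).2⟩)

/-- The normalized indicator function of a small neighbourhood of the identity in the first `k`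
coordinates has mean `1`, and its Fourier coefficients at finitely many given frequencies
in `Γ^k` are close to `1`. -/
lemma exists_kernel [μ.IsOpenPosMeasure] (k : ℕ) (A : Finset (Freq G))
    (hA : ∀ γ ∈ A, γ ∈ headFreq G k) :
    ∃ K : (ℕ → G) → ℝ, StronglyMeasurable[canonicalSigma G k] K ∧
      Integrable K (prodMeasure μ) ∧ (∀ x, 0 ≤ K x) ∧ ∫ x, K x ∂(prodMeasure μ) = 1 ∧
      ∀ γ ∈ A, 1 / 2 ≤ ‖∫ x, character (-γ) x • (K x : ℂ) ∂(prodMeasure μ)‖ := by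
  set P := prodMeasure μ
  set W : Set (ℕ → G) := {x | ∀ γ ∈ A, ‖character (-γ) x - 1‖ ≤ 1 / 2} with hW
  have hWm : MeasurableSet[canonicalSigma G k] W := by
    have : W = ⋂ γ ∈ A, {x | ‖character (-γ) x - 1‖ ≤ 1 / 2} := by ext; simp [hW]
    rw [this]
    refine @Finset.measurableSet_biInter _ _ (canonicalSigma G k) _ A fun γ hγ => ?_
    exact ((stronglyMeasurable_character (neg_mem_headFreq.2 (hA γ hγ))).sub
        stronglyMeasurable_const).norm.measurable measurableSet_Iic
  have hW' : MeasurableSet W := canonicalSigma_le k _ hWm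
  have hpos : P W ≠ 0 := by
    refine prodMeasure_ne_zero_of_isOpen μ
      (U := ⋂ γ ∈ A, {x | ‖character (-γ) x - 1‖ < 1 / 2}) ?_ ?_ ?_
    · exact isOpen_biInter_finset fun γ _ =>
        isOpen_lt ((continuous_character _).sub continuous_const).norm continuous_const
    · simp [character_one]
    · intro x hx γ hγ
      exact (Set.mem_iInter₂.1 hx γ hγ).le
  have hr : 0 < P.real W := ENNReal.toReal_pos hpos (measure_ne_top _ _)
  have hr1 : P.real W ≠ 0 := hr.ne'
  set K : (ℕ → G) → ℝ := W.indicator fun _ => (P.real W)⁻¹ with hK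
  have hKm : StronglyMeasurable[canonicalSigma G k] K :=
    (@stronglyMeasurable_const _ _ (canonicalSigma G k) _ _).indicator hWm
  have hK0 : ∀ x, 0 ≤ K x := fun x => Set.indicator_nonneg (fun _ _ => by positivity) x
  have hKi : Integrable K P := (integrable_const _).indicator hW'
  have hK1 : ∫ x, K x ∂P = 1 := by
    rw [hK, integral_indicator hW', setIntegral_const, smul_eq_mul, mul_inv_cancel₀ hr1]
  refine ⟨K, hKm, hKi, hK0, hK1, fun γ hγ => ?_⟩
  · have hKi' : Integrable (fun x => (K x : ℂ)) P := hKi.ofReal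
    have h1 : ∫ x, (character (-γ) x - 1) • (K x : ℂ) ∂P =
        ∫ x, character (-γ) x • (K x : ℂ) ∂P - 1 := by
      simp only [sub_smul, one_smul]
      rw [integral_sub (integrable_character_smul μ hKi' _) hKi', integral_complex_ofReal, hK1,
        Complex.ofReal_one]
    have h2 : ‖∫ x, (character (-γ) x - 1) • (K x : ℂ) ∂P‖ ≤ 1 / 2 := by
      refine (norm_integral_le_of_norm_le (hKi.const_mul (1 / 2)) (.of_forall fun x => ?_)).trans
        (le_of_eq ?_)
      · rw [norm_smul, Complex.norm_real, Real.norm_of_nonneg (hK0 x)]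
        by_cases hx : x ∈ W
        · exact mul_le_mul_of_nonneg_right (hx γ hγ) (hK0 x)
        · simp [hK, hx]
      · rw [integral_const_mul, hK1, mul_one]
    have h3 := norm_sub_norm_le (1 : ℂ) (1 - ∫ x, character (-γ) x • (K x : ℂ) ∂P)
    rw [h1, norm_sub_rev] at h2
    rw [sub_sub_cancel, norm_one] at h3
    linarith

end Kernel

/-! ### Test functions in a single martingale difference -/

section LastTest

variable {G : Type*} [MeasurableSpace G] {S : Type*} (μ : Measure G) [IsProbabilityMeasure μ]

lemma condExp_ofReal_smul_const {d : (ℕ → G) → ℝ} (hd : Integrable d (prodMeasure μ)) (v : Hil S)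
    (m : MeasurableSpace (ℕ → G)) :
    (prodMeasure μ)[fun x => d x • v | m] =ᵐ[prodMeasure μ]
      fun x => ((prodMeasure μ)[d | m]) x • v :=
  (ContinuousLinearMap.comp_condExp_comm hd
    ((ContinuousLinearMap.id ℝ ℝ).smulRight v)).symm

/-- If `d` is a scalar martingale difference of level `k`, the square function of `d • v` is
`|d| ‖v‖`. -/
lemma hardyNorm_smul_const_of_martDiff {d : (ℕ → G) → ℝ} (hd : Integrable d (prodMeasure μ)) {k : ℕ}
    (hdm : StronglyMeasurable[canonicalSigma G k] d)
    (hd0 : ∀ j < k, (prodMeasure μ)[d | canonicalSigma G j] =ᵐ[prodMeasure μ] 0) (v : Hil S) :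
    hardyNorm μ (fun x => d x • v) = (∫⁻ x, ‖d x‖ₑ ∂(prodMeasure μ)) * ‖v‖ₑ := by
  have hc : ∀ j, (prodMeasure μ)[fun x => d x • v | canonicalSigma G j] =ᵐ[prodMeasure μ]
      fun x => if k ≤ j then d x • v else 0 := by
    intro j
    refine (condExp_ofReal_smul_const μ hd v _).trans ?_
    by_cases hj : k ≤ j
    · rw [condExp_of_stronglyMeasurable (canonicalSigma_le j)
        (hdm.mono (canonicalSigma_mono hj)) hd]
      simp [hj]
    · filter_upwards [hd0 j (not_le.1 hj)] with x hx
      simp [hj, hx]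
  have hm : ∀ j, martDiff μ (fun x => d x • v) j =ᵐ[prodMeasure μ]
      fun x => if j = k then d x • v else 0 := by
    intro j
    cases j with
    | zero =>
      filter_upwards [hc 0] with x hx
      simp only [martDiff, hx]
      grind
    | succ j =>
      filter_upwards [hc j, hc (j + 1)] with x hx hx'
      simp only [martDiff, Pi.sub_apply, hx, hx']
      by_cases h1 : k ≤ j
      · simp [h1, show k ≤ j + 1 by omega, show j + 1 ≠ k by omega]
      · by_cases h2 : k ≤ j + 1
        · simp [h1, show j + 1 = k by omega]
        · simp [h1, h2, show j + 1 ≠ k by omega]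
  rw [hardyNorm, ← lintegral_mul_const' _ _ enorm_ne_top]
  refine lintegral_congr_ae ?_
  filter_upwards [ae_all_iff.2 hm] with x hx
  rw [tsum_eq_single k]
  · rw [hx, if_pos rfl, ← ENNReal.rpow_natCast, ← ENNReal.rpow_mul, enorm_smul]
    norm_num
  · intro j hj
    rw [hx, if_neg hj]
    simp

variable [CommGroup G] [TopologicalSpace G] [BorelSpace G] [IsTopologicalGroup G]
  [μ.IsMulLeftInvariant] [μ.IsOpenPosMeasure]

lemma sum_smul_unitVector_apply (P : Finset S) (c : S → ℂ) {s : S} (hs : s ∈ P) :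
    (∑ t ∈ P, c t • unitVector t : Hil S) s = c s := by
  rw [← inner_unitVector_left, inner_sum, Finset.sum_eq_single s]
  · rw [inner_smul_right, inner_unitVector_left, unitVector_apply, if_pos rfl, mul_one]
  · intro t _ hts
    rw [inner_smul_right, inner_unitVector_left, unitVector_apply, if_neg hts.symm, mul_zero]
  · exact fun h => (h hs).elim

lemma enorm_sum_smul_unitVector (P : Finset S) (c : S → ℝ≥0) :
    ‖(∑ t ∈ P, ((c t : ℝ) : ℂ) • unitVector t : Hil S)‖ₑ =
      (∑ t ∈ P, (c t : ℝ≥0∞) ^ 2) ^ (1 / 2 : ℝ) := by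
  have h : ‖(∑ t ∈ P, ((c t : ℝ) : ℂ) • unitVector t : Hil S)‖ ^ 2 = ∑ t ∈ P, (c t : ℝ) ^ 2 := by
    have h1 := inner_self_eq_norm_sq_to_K (𝕜 := ℂ) (∑ t ∈ P, ((c t : ℝ) : ℂ) • unitVector t : Hil S)
    rw [sum_inner] at h1
    have h2 : ∀ t ∈ P, inner ℂ (((c t : ℝ) : ℂ) • unitVector t : Hil S)
        (∑ t ∈ P, ((c t : ℝ) : ℂ) • unitVector t) = ((c t : ℝ) : ℂ) ^ 2 := by
      intro t ht
      rw [inner_smul_left, inner_unitVector_left, sum_smul_unitVector_apply P _ ht,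
        Complex.conj_ofReal, sq]
    rw [Finset.sum_congr rfl h2] at h1
    refine Complex.ofReal_injective ?_
    push_cast
    exact h1.symm
  have h3 : ∑ t ∈ P, (c t : ℝ≥0∞) ^ 2 =
      ‖(∑ t ∈ P, ((c t : ℝ) : ℂ) • unitVector t : Hil S)‖ₑ ^ 2 := by
    rw [← ofReal_norm, ← ENNReal.ofReal_pow (norm_nonneg _), h,
      ENNReal.ofReal_sum_of_nonneg fun _ _ => by positivity]
    simp
  rw [h3, ← ENNReal.rpow_natCast, ← ENNReal.rpow_mul]
  norm_num

/-- A normalized bump in the first `k` coordinates minus its conditional expectation given one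
coordinate less, times a vector. -/
lemma exists_lastFreq_test (k : ℕ) (A : Finset (Freq G)) (hA : ∀ γ ∈ A, γ ∈ lastFreq G k)
    (P : Finset S) (c : S → ℝ≥0) :
    ∃ f : (ℕ → G) → Hil S, MemHardy μ f ∧
      hardyNorm μ f ≤ 2 * (∑ s ∈ P, (c s : ℝ≥0∞) ^ 2) ^ (1 / 2 : ℝ) ∧
      ∀ s ∈ P, ∀ γ ∈ A, (c s : ℝ≥0∞) / 2 ≤ ‖fourierCoefficient μ f γ s‖ₑ := by
  obtain ⟨K, hKm, hKi, hK0, hK1, hKA⟩ := exists_kernel μ k A fun γ hγ => (hA γ hγ).1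
  have hKe := lintegral_enorm_eq_one hKi hK0 hK1
  -- The scalar martingale difference; for `k = 0` nothing is subtracted.
  obtain ⟨d, hdi, hdm, hd0, hde, hdA⟩ : ∃ d : (ℕ → G) → ℝ, Integrable d (prodMeasure μ) ∧
      StronglyMeasurable[canonicalSigma G k] d ∧
      (∀ j < k, (prodMeasure μ)[d | canonicalSigma G j] =ᵐ[prodMeasure μ] 0) ∧
      ∫⁻ x, ‖d x‖ₑ ∂(prodMeasure μ) ≤ 2 ∧
      ∀ γ ∈ A, 1 / 2 ≤ ‖∫ x, character (-γ) x • (d x : ℂ) ∂(prodMeasure μ)‖ := by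
    cases k with
    | zero => exact ⟨K, hKi, hKm, by simp, by rw [hKe]; norm_num, hKA⟩
    | succ k =>
      set K' := (prodMeasure μ)[K | canonicalSigma G k] with hK'
      have hK'i : Integrable K' (prodMeasure μ) := integrable_condExp
      refine ⟨K - K', hKi.sub hK'i,
        hKm.sub (stronglyMeasurable_condExp.mono (canonicalSigma_mono k.le_succ)),
        fun j hj => ?_, ?_, fun γ hγ => ?_⟩
      · have h1 := condExp_sub hKi hK'i (canonicalSigma G j)
        have h2 : (prodMeasure μ)[K' | canonicalSigma G j] =ᵐ[prodMeasure μ]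
            (prodMeasure μ)[K | canonicalSigma G j] :=
          condExp_condExp_of_le (canonicalSigma_mono (Nat.lt_succ_iff.1 hj)) (canonicalSigma_le k)
        filter_upwards [h1, h2] with x hx1 hx2
        rw [hx1, Pi.sub_apply, hx2, sub_self, Pi.zero_apply]
      · have h1 := eLpNorm_condExp_le_eLpNorm (m := canonicalSigma G k) (μ := prodMeasure μ)
          K le_rfl
        rw [eLpNorm_one_eq_lintegral_enorm, eLpNorm_one_eq_lintegral_enorm, hKe] at h1
        calc _ ≤ ∫⁻ x, (‖K x‖ₑ + ‖K' x‖ₑ) ∂(prodMeasure μ) :=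
              lintegral_mono fun x => enorm_sub_le
          _ = ∫⁻ x, ‖K x‖ₑ ∂(prodMeasure μ) + ∫⁻ x, ‖K' x‖ₑ ∂(prodMeasure μ) :=
              lintegral_add_left' hKi.aestronglyMeasurable.enorm _
          _ ≤ 1 + 1 := add_le_add hKe.le h1
          _ = 2 := one_add_one_eq_two
      · have h0 : ∫ x, character (-γ) x • (K' x : ℂ) ∂(prodMeasure μ) = 0 := by
          refine integral_character_smul_eq_zero μ (m := k) (fun h =>
            notMem_headFreq_of_mem_lastFreq k.lt_succ_self (hA γ hγ) (neg_mem_headFreq.1 h)) ?_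
          intro x y hxy
          have := dependsOn_of_stronglyMeasurable (k := k) (g := K') stronglyMeasurable_condExp hxy
          simp only [this]
        have h1 : ∫ x, character (-γ) x • (((K - K') x : ℝ) : ℂ) ∂(prodMeasure μ) =
            ∫ x, character (-γ) x • (K x : ℂ) ∂(prodMeasure μ) := by
          simp only [Pi.sub_apply, Complex.ofReal_sub, smul_sub]
          rw [integral_sub (integrable_character_smul μ hKi.ofReal _)
            (integrable_character_smul μ hK'i.ofReal _), h0, sub_zero]
        rw [h1]
        exact hKA γ hγ
  set v : Hil S := ∑ t ∈ P, ((c t : ℝ) : ℂ) • unitVector t with hv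
  have hnorm := hardyNorm_smul_const_of_martDiff μ hdi hdm hd0 v
  have hle : hardyNorm μ (fun x => d x • v) ≤ 2 * (∑ s ∈ P, (c s : ℝ≥0∞) ^ 2) ^ (1 / 2 : ℝ) := by
    rw [hnorm, hv, enorm_sum_smul_unitVector]
    gcongr
  refine ⟨fun x => d x • v, ⟨hdi.smul_const v, ?_⟩, hle, fun s hs γ hγ => ?_⟩
  · rw [hnorm]
    exact ENNReal.mul_lt_top (hde.trans_lt (by norm_num)) enorm_lt_top
  · have h1 : fourierCoefficient μ (fun x => d x • v) γ =
        (∫ x, character (-γ) x • (d x : ℂ) ∂(prodMeasure μ)) • v := by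
      rw [fourierCoefficient, ← integral_smul_const]
      refine integral_congr_ae (.of_forall fun x => ?_)
      simp only [character_neg, smul_eq_mul, mul_smul, Complex.coe_smul]
      rfl
    rw [h1, lp.coeFn_smul, Pi.smul_apply, enorm_smul, hv, sum_smul_unitVector_apply P _ hs]
    rw [enorm_ofReal_coe, ENNReal.div_eq_inv_mul]
    gcongr
    rw [← ofReal_norm, ← ENNReal.ofReal_ofNat 2, ← ENNReal.ofReal_inv_of_pos (by norm_num)]
    exact ENNReal.ofReal_le_ofReal (by simpa using hdA γ hγ)

end LastTest

/-! ### Test functions concentrated in the head and spread over the tail -/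

section TailTest

variable {G : Type*} [CommGroup G] [TopologicalSpace G] {S : Type*}
  {k : ℕ} {P : Finset (Freq G × S)} {c : Freq G × S → ℝ≥0}

/-- Frequencies of the tail that agree modulo `Γ^k` are equal, so only diagonal pairs remain. -/
lemma sum_levelPairs_tailFreq (hP : ∀ p ∈ P, p.1 ∈ tailFreq G k) (j : ℕ) :
    ∑ z ∈ levelPairs P k j, (c z.1 * c z.2 : ℝ) = ∑ p ∈ P with level p.1 = j, (c p : ℝ) ^ 2 := by
  symm
  refine Finset.sum_bij (fun p _ => (p, p)) ?_ ?_ ?_ fun p _ => sq _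
  · intro p hp
    have := Finset.mem_filter.1 hp
    simp only [levelPairs, Finset.mem_filter, Finset.mem_product, this, true_and, and_self,
      sub_self]
    exact fun _ _ => rfl
  · intro p _ q _ h
    exact congrArg Prod.fst h
  · rintro ⟨p, q⟩ hz
    simp only [levelPairs, Finset.mem_filter, Finset.mem_product] at hz
    obtain ⟨⟨hp, hq⟩, h1, h2, h3, h4⟩ := hz
    have : p = q := Prod.ext (eq_of_sub_mem_headFreq (hP q hq) (hP p hp) h4).symm h3
    subst this
    exact ⟨p, Finset.mem_filter.2 ⟨hp, h1⟩, rfl⟩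

/-- The product of a function of the first `k` coordinates and the polynomial
`∑ c_{γ,s} γ(x) e_s`. -/
noncomputable def headTail (K : (ℕ → G) → ℝ) (P : Finset (Freq G × S)) (c : Freq G × S → ℝ≥0)
    (x : ℕ → G) : Hil S :=
  ∑ p ∈ P, character p.1 x • ((K x * c p : ℝ) : ℂ) • unitVector p.2

variable [MeasurableSpace G] {K : (ℕ → G) → ℝ}

lemma dependsOn_headTail_summand (hKm : StronglyMeasurable[canonicalSigma G k] K)
    (p : Freq G × S) :
    DependsOn (fun x => ((K x * c p : ℝ) : ℂ) • unitVector p.2) (Set.Iio k) := fun x y hxy => by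
  have := dependsOn_of_stronglyMeasurable hKm hxy
  simp only [this]

variable (μ : Measure G) [IsProbabilityMeasure μ]

lemma integrable_headTail_summand (hKi : Integrable K (prodMeasure μ)) (p : Freq G × S) :
    Integrable (fun x => ((K x * c p : ℝ) : ℂ) • unitVector p.2) (prodMeasure μ) :=
  ((hKi.mul_const _).ofReal).smul_const _

variable [BorelSpace G]

lemma integrable_headTail (hKi : Integrable K (prodMeasure μ)) :
    Integrable (headTail K P c) (prodMeasure μ) :=
  integrable_finsetSum _ fun p _ =>
    integrable_character_smul μ (integrable_headTail_summand μ hKi p) p.1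

variable [IsTopologicalGroup G] [μ.IsMulLeftInvariant]

/-- Conditioning on `ℱ_j` keeps exactly the terms of level at most `j`. -/
lemma condExp_headTail (hP : ∀ p ∈ P, p.1 ∈ tailFreq G k)
    (hKm : StronglyMeasurable[canonicalSigma G k] K) (hKi : Integrable K (prodMeasure μ)) (j : ℕ) :
    (prodMeasure μ)[headTail K P c | canonicalSigma G j] =ᵐ[prodMeasure μ] fun x =>
      ∑ p ∈ P, if level p.1 ≤ j then character p.1 x • ((K x * c p : ℝ) : ℂ) • unitVector p.2
        else 0 := by
  have hI := fun p : Freq G × S =>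
    integrable_character_smul μ (integrable_headTail_summand (c := c) μ hKi p) p.1
  have hfun : headTail K P c = ∑ p ∈ P, fun x =>
      character p.1 x • ((K x * c p : ℝ) : ℂ) • unitVector p.2 := by
    ext1 x
    rw [headTail, Finset.sum_apply]
  have hp : ∀ p ∈ P, (prodMeasure μ)[fun x =>
      character p.1 x • ((K x * c p : ℝ) : ℂ) • unitVector p.2 | canonicalSigma G j]
      =ᵐ[prodMeasure μ] fun x =>
      if level p.1 ≤ j then character p.1 x • ((K x * c p : ℝ) : ℂ) • unitVector p.2 else 0 := by
    intro p hp
    have hk : k < level p.1 := by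
      by_contra h
      exact notMem_headFreq_of_mem_tailFreq (hP p hp) (mem_headFreq_iff_level_le.2 (not_lt.1 h))
    by_cases hj : level p.1 ≤ j
    · simp only [if_pos hj]
      rw [condExp_of_stronglyMeasurable (canonicalSigma_le j) _ (hI p)]
      refine (stronglyMeasurable_character (mem_headFreq_iff_level_le.2 hj)).smul
        (StronglyMeasurable.smul_const ?_ _)
      exact Complex.continuous_ofReal.comp_stronglyMeasurable
        ((hKm.mono (canonicalSigma_mono (hk.le.trans hj))).mul_const _)
    · simp only [if_neg hj]
      refine condExp_character_smul_eq_zero μ (m := k) (fun h => ?_)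
        (dependsOn_headTail_summand hKm p) (integrable_headTail_summand μ hKi p)
      have := mem_headFreq_iff_level_le.1 h
      omega
  rw [hfun]
  refine (condExp_finsetSum (fun p _ => hI p) _).trans ?_
  have hall := (Finset.eventually_all P).2 hp
  filter_upwards [hall] with x hx
  rw [Finset.sum_apply]
  exact Finset.sum_congr rfl hx

lemma martDiff_headTail (hP : ∀ p ∈ P, p.1 ∈ tailFreq G k)
    (hKm : StronglyMeasurable[canonicalSigma G k] K) (hKi : Integrable K (prodMeasure μ)) (j : ℕ) :
    martDiff μ (headTail K P c) j =ᵐ[prodMeasure μ] fun x =>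
      (K x : ℂ) • levelPoly P (fun p => ((c p : ℝ) : ℂ)) j x := by
  have hterm : ∀ x, (K x : ℂ) • levelPoly P (fun p => ((c p : ℝ) : ℂ)) j x =
      ∑ p ∈ P, if level p.1 = j then character p.1 x • ((K x * c p : ℝ) : ℂ) • unitVector p.2
        else 0 := by
    intro x
    rw [levelPoly, Finset.sum_filter, Finset.smul_sum]
    refine Finset.sum_congr rfl fun p _ => ?_
    split_ifs
    · rw [smul_smul, smul_smul]
      congr 1
      push_cast
      ring
    · exact smul_zero _
  simp only [hterm]
  cases j with
  | zero =>
    filter_upwards [condExp_headTail (c := c) μ hP hKm hKi 0] with x hx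
    simp only [martDiff, hx, Nat.le_zero]
  | succ j =>
    filter_upwards [condExp_headTail (c := c) μ hP hKm hKi j,
      condExp_headTail (c := c) μ hP hKm hKi (j + 1)]
      with x hx hx'
    simp only [martDiff, Pi.sub_apply, hx, hx']
    rw [← Finset.sum_sub_distrib]
    refine Finset.sum_congr rfl fun p _ => ?_
    rcases lt_trichotomy (level p.1) (j + 1) with h | h | h
    · rw [if_pos h.le, if_pos (Nat.lt_succ_iff.1 h), if_neg h.ne, sub_self]
    · rw [if_pos h.le, if_neg (by omega), if_pos h, sub_zero]
    · rw [if_neg (by omega), if_neg (by omega), if_neg (by omega), sub_zero]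

/-- By the Cauchy–Schwarz inequality for the probability measure with density `K`. -/
lemma hardyNorm_headTail_le (hP : ∀ p ∈ P, p.1 ∈ tailFreq G k)
    (hKm : StronglyMeasurable[canonicalSigma G k] K) (hKi : Integrable K (prodMeasure μ))
    (hK0 : ∀ x, 0 ≤ K x) (hK1 : ∫ x, K x ∂(prodMeasure μ) = 1) :
    hardyNorm μ (headTail K P c) ≤ (∑ p ∈ P, (c p : ℝ≥0∞) ^ 2) ^ (1 / 2 : ℝ) := by
  set a : Freq G × S → ℂ := fun p => ((c p : ℝ) : ℂ) with ha
  have hKae : AEMeasurable (fun x => ‖K x‖ₑ) (prodMeasure μ) := hKi.aestronglyMeasurable.enorm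
  have hLm : ∀ j, AEMeasurable (fun x => ‖K x‖ₑ * ‖levelPoly P a j x‖ₑ ^ 2) (prodMeasure μ) :=
    fun j => hKae.mul ((stronglyMeasurable_levelPoly P a j).aestronglyMeasurable.enorm.pow_const 2)
  have hK := lintegral_enorm_eq_one hKi hK0 hK1
  have hL : ∀ j, ∫⁻ x, ‖K x‖ₑ * ‖levelPoly P a j x‖ₑ ^ 2 ∂(prodMeasure μ) ≤
      ∑ p ∈ P, if level p.1 = j then (c p : ℝ≥0∞) ^ 2 else 0 := by
    intro j
    have h1 := integral_mul_norm_levelPoly_sq_le μ P (a := a) (lam := fun γ s => c (γ, s))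
      (fun p => by simp [ha]) k j (dependsOn_of_stronglyMeasurable hKm) hKi hK0
    have h2 : Integrable (fun x => K x * ‖levelPoly P a j x‖ ^ 2) (prodMeasure μ) := by
      refine hKi.mul_bdd (c := (∑ p ∈ P with level p.1 = j, ‖a p‖ * ‖unitVector p.2‖) ^ 2)
        ((stronglyMeasurable_levelPoly P a j).norm.pow 2).aestronglyMeasurable
        (.of_forall fun x => ?_)
      rw [norm_pow, norm_norm]
      exact pow_le_pow_left₀ (norm_nonneg _) (norm_levelPoly_le P a j x) 2
    have h3 : ∫⁻ x, ‖K x‖ₑ * ‖levelPoly P a j x‖ₑ ^ 2 ∂(prodMeasure μ) =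
        ENNReal.ofReal (∫ x, K x * ‖levelPoly P a j x‖ ^ 2 ∂(prodMeasure μ)) := by
      rw [ofReal_integral_eq_lintegral_ofReal h2
        (.of_forall fun x => mul_nonneg (hK0 x) (sq_nonneg _))]
      refine lintegral_congr fun x => ?_
      rw [ENNReal.ofReal_mul (hK0 x), ENNReal.ofReal_pow (norm_nonneg _), ofReal_norm,
        Real.enorm_of_nonneg (hK0 x)]
    have h4 : ∑ z ∈ levelPairs P k j, ((c (z.1.1, z.1.2) : ℝ) * c (z.2.1, z.2.2)) =
        ∑ p ∈ P with level p.1 = j, (c p : ℝ) ^ 2 := sum_levelPairs_tailFreq hP j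
    rw [h4, hK1, mul_one] at h1
    rw [h3, ← Finset.sum_filter]
    refine (ENNReal.ofReal_le_ofReal h1).trans (le_of_eq ?_)
    rw [ENNReal.ofReal_sum_of_nonneg fun _ _ => sq_nonneg _]
    simp [ENNReal.ofReal_pow]
  have hpt : hardyNorm μ (headTail K P c) =
      ∫⁻ x, ‖K x‖ₑ ^ (1 / 2 : ℝ) * (∑' j, ‖K x‖ₑ * ‖levelPoly P a j x‖ₑ ^ 2) ^ (1 / 2 : ℝ)
        ∂(prodMeasure μ) := by
    rw [hardyNorm]
    refine lintegral_congr_ae ?_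
    filter_upwards [ae_all_iff.2 (martDiff_headTail (c := c) μ hP hKm hKi)] with x hx
    rw [← ENNReal.mul_rpow_of_nonneg _ _ (by norm_num), ← ENNReal.tsum_mul_left]
    congr 1
    refine tsum_congr fun j => ?_
    have hKc : ‖(K x : ℂ)‖ₑ = ‖K x‖ₑ := by rw [← ofReal_norm, Complex.norm_real, ofReal_norm]
    rw [hx j, enorm_smul, hKc]
    ring
  have hsq : ∀ y : ℝ≥0∞, (y ^ (1 / 2 : ℝ)) ^ (2 : ℝ) = y := fun y => by
    rw [← ENNReal.rpow_mul]; norm_num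
  have hTm : AEMeasurable (fun x => ∑' j, ‖K x‖ₑ * ‖levelPoly P a j x‖ₑ ^ 2) (prodMeasure μ) :=
    AEMeasurable.tsum hLm
  have hCS := ENNReal.lintegral_mul_le_Lp_mul_Lq (prodMeasure μ) Real.HolderConjugate.two_two
    (hKae.pow_const (1 / 2 : ℝ)) (hTm.pow_const (1 / 2 : ℝ))
  rw [hpt]
  refine hCS.trans ?_
  simp only [hsq]
  rw [hK, ENNReal.one_rpow, one_mul, lintegral_tsum hLm]
  refine ENNReal.rpow_le_rpow ?_ (by norm_num)
  refine (ENNReal.tsum_le_tsum hL).trans (le_of_eq ?_)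
  rw [Summable.tsum_finsetSum fun _ _ => ENNReal.summable]
  refine Finset.sum_congr rfl fun p _ => ?_
  rw [tsum_eq_single (level p.1) (fun j hj => if_neg hj.symm), if_pos rfl]

/-- The terms of the polynomial are orthogonal modulo functions of the first `k` coordinates, so the
coefficient at `η ⊗ γ'` factors. -/
lemma fourierCoefficient_headTail (hP : ∀ p ∈ P, p.1 ∈ tailFreq G k)
    (hKm : StronglyMeasurable[canonicalSigma G k] K) (hKi : Integrable K (prodMeasure μ))
    {p : Freq G × S} (hp : p ∈ P) {η : Freq G} (hη : η ∈ headFreq G k) :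
    fourierCoefficient μ (headTail K P c) (η + p.1) p.2 =
      (c p : ℝ) * ∫ x, character (-η) x • (K x : ℂ) ∂(prodMeasure μ) := by
  have hint := integrable_character_smul μ
    (integrable_headTail (P := P) (c := c) μ hKi) (-(η + p.1))
  have h1 : fourierCoefficient μ (headTail K P c) (η + p.1) p.2 =
      ∫ x, inner ℂ (unitVector p.2) (character (-(η + p.1)) x • headTail K P c x)
        ∂(prodMeasure μ) := by
    rw [integral_inner hint, inner_unitVector_left, fourierCoefficient]
    simp only [character_neg]
  have h2 : ∀ x, inner ℂ (unitVector p.2) (character (-(η + p.1)) x • headTail K P c x) =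
      ∑ q ∈ P, (unitVector q.2 : Hil S) p.2 * (c q : ℝ) *
        (character (q.1 - p.1) x • (character (-η) x • (K x : ℂ))) := by
    intro x
    rw [inner_smul_right, headTail, inner_sum, Finset.mul_sum]
    refine Finset.sum_congr rfl fun q _ => ?_
    rw [inner_smul_right, inner_smul_right, inner_unitVector_left, neg_add, sub_eq_add_neg,
      character_add, character_add]
    push_cast
    simp only [smul_eq_mul]
    ring
  have hKη := integrable_character_smul μ hKi.ofReal (-η) (f := fun x => (K x : ℂ))
  rw [h1]
  simp_rw [h2]
  rw [integral_finsetSum _ fun q _ => (integrable_character_smul μ hKη _).const_mul _,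
    Finset.sum_eq_single p]
  · rw [integral_const_mul, unitVector_apply, if_pos rfl, one_mul, sub_self]
    simp only [character_zero, one_smul]
  · intro q hq hqp
    rw [integral_const_mul, unitVector_apply]
    split_ifs with hs
    · rw [integral_character_smul_eq_zero μ (m := k), mul_zero]
      · exact fun h => hqp (Prod.ext (eq_of_sub_mem_headFreq (hP q hq) (hP p hp) h) hs.symm)
      · intro x y hxy
        have e1 := dependsOn_of_stronglyMeasurable hKm hxy
        have e2 := dependsOn_of_stronglyMeasurable
          (stronglyMeasurable_character (neg_mem_headFreq.2 hη)) hxy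
        simp only [e1, e2]
    · simp
  · exact fun h => (h hp).elim

/-- A normalized bump in the first `k` coordinates times a polynomial in the tail frequencies. -/
lemma exists_tailFreq_test [μ.IsOpenPosMeasure] (k : ℕ) (A : Finset (Freq G))
    (hA : ∀ η ∈ A, η ∈ headFreq G k) (P : Finset (Freq G × S)) (hP : ∀ p ∈ P, p.1 ∈ tailFreq G k)
    (c : Freq G × S → ℝ≥0) :
    ∃ f : (ℕ → G) → Hil S, MemHardy μ f ∧
      hardyNorm μ f ≤ (∑ p ∈ P, (c p : ℝ≥0∞) ^ 2) ^ (1 / 2 : ℝ) ∧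
      ∀ p ∈ P, ∀ η ∈ A, (c p : ℝ≥0∞) / 2 ≤ ‖fourierCoefficient μ f (η + p.1) p.2‖ₑ := by
  obtain ⟨K, hKm, hKi, hK0, hK1, hKA⟩ := exists_kernel μ k A hA
  have hle := hardyNorm_headTail_le (c := c) μ hP hKm hKi hK0 hK1
  refine ⟨headTail K P c, ⟨integrable_headTail μ hKi, hle.trans_lt ?_⟩, hle, fun p hp η hη => ?_⟩
  · exact ENNReal.rpow_lt_top_of_nonneg (by norm_num) (ENNReal.sum_lt_top.2 fun p _ => by
      simp).ne
  · rw [fourierCoefficient_headTail μ hP hKm hKi hp (hA η hη), enorm_mul]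
    rw [enorm_ofReal_coe, ENNReal.div_eq_inv_mul, mul_comm]
    gcongr
    rw [← ofReal_norm, ← ENNReal.ofReal_ofNat 2, ← ENNReal.ofReal_inv_of_pos (by norm_num)]
    exact ENNReal.ofReal_le_ofReal (by simpa using hKA η hη)

end TailTest

/-! ### The lower bound -/

section Lower

lemma tsum_sq_tsum_le {ι κ : Type*} {f : ι → κ → ℝ≥0∞} {X : ℝ≥0∞}
    (h : ∀ (P : Finset ι) (A : Finset κ), ∑ i ∈ P, (∑ η ∈ A, f i η) ^ 2 ≤ X) :
    ∑' i, (∑' η, f i η) ^ 2 ≤ X := by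
  rw [ENNReal.tsum_eq_iSup_sum]
  refine iSup_le fun P => ?_
  refine le_of_tendsto' (tendsto_finsetSum P fun i _ =>
    ENNReal.Tendsto.pow (ENNReal.summable (f := f i)).hasSum) fun A => h P A

variable {G : Type*} [CommGroup G] [TopologicalSpace G] {S : Type*} [MeasurableSpace G]
  (μ : Measure G) [IsProbabilityMeasure μ]

/-- If a test function has norm at most `D` times the `ℓ²` norm of `c_i = ∑_{η ∈ A} λ_{φ(i,η)}`, and
its Fourier coefficient at `φ(i,η)` is at least `c_i / 2`, then the multiplier inequality for it
bounds the `ℓ²` norm of `c`. -/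
lemma sum_sq_le_of_test {ι κ : Type*} {lam : Freq G → S → ℝ≥0} {C D : ℝ≥0∞}
    (hC : ∀ f : (ℕ → G) → Hil S, MemHardy μ f →
      ∑' p : Freq G × S, (lam p.1 p.2 : ℝ≥0∞) * ‖fourierCoefficient μ f p.1 p.2‖ₑ
        ≤ C * hardyNorm μ f)
    (P : Finset ι) (A : Finset κ) (φ : ι × κ → Freq G × S) (hφ : Function.Injective φ)
    (htest : ∀ c : ι → ℝ≥0, ∃ f : (ℕ → G) → Hil S, MemHardy μ f ∧
      hardyNorm μ f ≤ D * (∑ i ∈ P, (c i : ℝ≥0∞) ^ 2) ^ (1 / 2 : ℝ) ∧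
      ∀ i ∈ P, ∀ η ∈ A,
        (c i : ℝ≥0∞) / 2 ≤ ‖fourierCoefficient μ f (φ (i, η)).1 (φ (i, η)).2‖ₑ) :
    ∑ i ∈ P, (∑ η ∈ A, (lam (φ (i, η)).1 (φ (i, η)).2 : ℝ≥0∞)) ^ 2 ≤ (2 * D * C) ^ 2 := by
  set c : ι → ℝ≥0 := fun i => ∑ η ∈ A, lam (φ (i, η)).1 (φ (i, η)).2 with hc
  have hcE : ∀ i, ∑ η ∈ A, (lam (φ (i, η)).1 (φ (i, η)).2 : ℝ≥0∞) = c i := fun i => by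
    simp [hc]
  simp only [hcE]
  obtain ⟨f, hf, hnorm, hcoef⟩ := htest c
  set X : ℝ≥0∞ := ∑ i ∈ P, (c i : ℝ≥0∞) ^ 2 with hX
  set Y : ℝ≥0∞ := X ^ (1 / 2 : ℝ) with hY
  have hXY : X = Y ^ 2 := by
    rw [hY, ← ENNReal.rpow_natCast, ← ENNReal.rpow_mul]; norm_num
  have hXtop : X ≠ ∞ := (ENNReal.sum_lt_top.2 fun i _ => by simp).ne
  have hYtop : Y ≠ ∞ := ENNReal.rpow_ne_top_of_nonneg (by norm_num) hXtop
  have hlow : X / 2 ≤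
      ∑' p : Freq G × S, (lam p.1 p.2 : ℝ≥0∞) * ‖fourierCoefficient μ f p.1 p.2‖ₑ := by
    refine le_trans ?_ (ENNReal.tsum_comp_le_tsum_of_injective hφ _)
    refine le_trans ?_ (ENNReal.sum_le_tsum (P ×ˢ A))
    rw [Finset.sum_product, hX, ENNReal.div_eq_inv_mul, Finset.mul_sum]
    refine Finset.sum_le_sum fun i hi => ?_
    calc _ = ∑ η ∈ A, (lam (φ (i, η)).1 (φ (i, η)).2 : ℝ≥0∞) * ((c i : ℝ≥0∞) / 2) := by
          rw [← Finset.sum_mul, hcE, ENNReal.div_eq_inv_mul]; ring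
      _ ≤ _ := Finset.sum_le_sum fun η hη => by gcongr; exact hcoef i hi η hη
  have hmain : X / 2 ≤ C * (D * Y) := hlow.trans ((hC f hf).trans (by gcongr))
  rw [hXY]
  refine pow_le_pow_left' ?_ 2
  rcases eq_or_ne Y 0 with h0 | h0
  · rw [h0]; exact zero_le
  · rw [ENNReal.div_le_iff (by norm_num) (by norm_num), hXY, sq] at hmain
    refine (ENNReal.mul_le_mul_iff_left h0 hYtop).1 (hmain.trans (le_of_eq ?_))
    ring

variable [BorelSpace G] [IsTopologicalGroup G] [μ.IsMulLeftInvariant] [μ.IsOpenPosMeasure]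

lemma tailTerm_le {lam : Freq G → S → ℝ≥0} {C : ℝ≥0∞}
    (hC : ∀ f : (ℕ → G) → Hil S, MemHardy μ f →
      ∑' p : Freq G × S, (lam p.1 p.2 : ℝ≥0∞) * ‖fourierCoefficient μ f p.1 p.2‖ₑ
        ≤ C * hardyNorm μ f) : tailTerm lam ≤ 2 * C := by
  classical
  refine iSup_le fun k => ?_
  rw [one_div, ENNReal.rpow_inv_le_iff (by norm_num), ← ENNReal.tsum_prod]
  have key := tsum_sq_tsum_le (X := (2 * 1 * C) ^ 2)
    (f := fun (i : tailFreq G k × S) (η : headFreq G k) =>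
      (lam ((η : Freq G) + (i.1 : Freq G)) i.2 : ℝ≥0∞)) fun P A => by
    refine sum_sq_le_of_test μ hC P A (fun y => ((y.2 : Freq G) + (y.1.1 : Freq G), y.1.2)) ?_ ?_
    · rintro ⟨⟨γ₁, s₁⟩, η₁⟩ ⟨⟨γ₂, s₂⟩, η₂⟩ h
      obtain ⟨h1, h2⟩ := Prod.mk.inj h
      obtain ⟨h3, h4⟩ := add_eq_add_iff η₁.2 η₂.2 γ₁.2 γ₂.2 h1
      exact Prod.ext (Prod.ext (Subtype.ext h4) h2) (Subtype.ext h3)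
    · intro c
      have hinj : Function.Injective fun i : tailFreq G k × S => ((i.1 : Freq G), i.2) := by
        rintro ⟨γ₁, s₁⟩ ⟨γ₂, s₂⟩ h
        obtain ⟨h1, h2⟩ := Prod.mk.inj h
        exact Prod.ext (Subtype.ext h1) h2
      obtain ⟨f, hf, hn, hco⟩ := exists_tailFreq_test μ k (A.map (Function.Embedding.subtype _))
        (by simp only [Finset.forall_mem_map]; exact fun η _ => η.2) (P.map ⟨_, hinj⟩)
        (by simp only [Finset.forall_mem_map]; exact fun i _ => i.1.2)
        (fun p => if h : p.1 ∈ tailFreq G k then c (⟨p.1, h⟩, p.2) else 0)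
      refine ⟨f, hf, ?_, fun i hi η hη => ?_⟩
      · rw [one_mul]
        refine hn.trans (le_of_eq ?_)
        simp
      · have := hco _ (Finset.mem_map_of_mem _ hi) _ (Finset.mem_map_of_mem _ hη)
        simpa using this
  simpa using key

lemma lastTerm_le {lam : Freq G → S → ℝ≥0} {C : ℝ≥0∞}
    (hC : ∀ f : (ℕ → G) → Hil S, MemHardy μ f →
      ∑' p : Freq G × S, (lam p.1 p.2 : ℝ≥0∞) * ‖fourierCoefficient μ f p.1 p.2‖ₑ
        ≤ C * hardyNorm μ f) : lastTerm lam ≤ 4 * C := by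
  refine iSup_le fun k => ?_
  rw [one_div, ENNReal.rpow_inv_le_iff (by norm_num)]
  have key := tsum_sq_tsum_le (X := (2 * 2 * C) ^ 2)
    (f := fun (s : S) (η : lastFreq G k) => (lam (η : Freq G) s : ℝ≥0∞)) fun P A => by
    refine sum_sq_le_of_test μ hC P A (fun y => ((y.2 : Freq G), y.1)) ?_ fun c => ?_
    · rintro ⟨s₁, η₁⟩ ⟨s₂, η₂⟩ h
      obtain ⟨h1, h2⟩ := Prod.mk.inj h
      exact Prod.ext h2 (Subtype.ext h1)
    · obtain ⟨f, hf, hn, hco⟩ := exists_lastFreq_test μ k (A.map (Function.Embedding.subtype _))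
        (by simp only [Finset.forall_mem_map]; exact fun η _ => η.2) P c
      exact ⟨f, hf, hn, fun i hi η hη => hco i hi _ (Finset.mem_map_of_mem _ hη)⟩
  refine key.trans (le_of_eq ?_)
  norm_num

theorem le_multiplierNorm (lam : Freq G → S → ℝ≥0) :
    ((1 / 6 : ℝ≥0) : ℝ≥0∞) * (tailTerm lam + lastTerm lam) ≤ multiplierNorm μ lam := by
  refine le_sInf fun C hC => ?_
  have h : tailTerm lam + lastTerm lam ≤ 6 * C :=
    (add_le_add (tailTerm_le μ hC) (lastTerm_le μ hC)).trans (le_of_eq (by ring))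
  calc _ ≤ ((1 / 6 : ℝ≥0) : ℝ≥0∞) * (6 * C) := by gcongr
    _ = C := by
      rw [← mul_assoc, ← ENNReal.coe_ofNat, ← ENNReal.coe_mul]
      norm_num

end Lower

end HardyMultiplier

theorem mainTheorem2 :
    ∃ c C : ℝ≥0, 0 < c ∧ 0 < C ∧
      ∀ (G : Type*) [CommGroup G] [TopologicalSpace G] [IsTopologicalGroup G] [CompactSpace G]
        [MeasurableSpace G] [BorelSpace G]
        (μ : Measure G) [μ.IsHaarMeasure] [IsProbabilityMeasure μ]
        (S : Type*) (lam : HardyMultiplier.Freq G → S → ℝ≥0),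
        (c : ℝ≥0∞) * (HardyMultiplier.tailTerm lam + HardyMultiplier.lastTerm lam)
            ≤ HardyMultiplier.multiplierNorm μ lam ∧
          HardyMultiplier.multiplierNorm μ lam
            ≤ (C : ℝ≥0∞) * (HardyMultiplier.tailTerm lam + HardyMultiplier.lastTerm lam) :=
  ⟨1 / 6, 3 / 2, by norm_num, by norm_num, fun _ _ _ _ _ _ _ μ _ _ _ lam =>
    ⟨HardyMultiplier.le_multiplierNorm μ lam, HardyMultiplier.multiplierNorm_le μ lam⟩⟩
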